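/- Let $G$ be a finite simple graph that is a forest (i.e. acyclic), with vertex set $V$, and let $k\ge 0$ be an integer. For a field $K$, let $S_K=K[x_v : v\in V]$ with the standard grading, and let $I_K(G)^{[k]}\subseteq S_K$ be the $k$-th squarefree power of the edge ideal of $G$, that is, the ideal generated by the monomials $\prod_{v\in V(M)}x_v$, where $M$ ranges over the $k$-matchings of $G$ (sets of $k$ pairwise disjoint edges) and $V(M)$ is the set of vertices covered by $M$. (If $k$ exceeds the matching number of $G$, this is the zero ideal; for $k=0$ it is $S_K$.) Let $\beta_{i,j}(I_K(G)^{[k]})$ be its graded Betti numbers, i.e. the number of copies of $S_K(-j)$ in the $i$-th module of a minimal graded free resolution of $I_K(G)^{[k]}$ over $S_K$. Then these graded Betti numbers do not depend on the field, in particular not on its characteristic: for any two fields $K$ and $L$, minimal graded free resolutions of $I_K(G)^{[k]}$ over $S_K$ and of $I_L(G)^{[k]}$ over $S_L$ exist, and for any choice of them $$\beta_{i,j}\bigl(I_K(G)^{[k]}\bigr)=\beta_{i,j}\bigl(I_L(G)^{[k]}\bigr)\qquad\text{for all } i,j\ge 0 .$$ -/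

import Mathlib

open MvPolynomial

noncomputable section

/-- A `k`-matching of `G`: a set of `k` pairwise disjoint edges of `G`. -/
structure IsKMatching {V : Type*} (G : SimpleGraph V) (k : ℕ) (M : Finset (Sym2 V)) : Prop where
  subset_edgeSet : ∀ e ∈ M, e ∈ G.edgeSet
  card_eq : M.card = k
  pairwise_disjoint : ∀ e ∈ M, ∀ e' ∈ M, e ≠ e' → ∀ v, v ∈ e → v ∉ e'

open Classical in
/-- The vertex set `V(M)` of a set `M` of edges. -/
def matchingVertices {V : Type*} (M : Finset (Sym2 V)) : Finset V :=
  M.biUnion Sym2.toFinset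

/-- The squarefree power `I(G)^{[k]}` of the edge ideal of `G` over `K`: the ideal of
`K[x_v : v ∈ V]` generated by the monomials `x_{V(M)} = ∏_{v ∈ V(M)} x_v`, where `M` runs over
the `k`-matchings of `G`. For `k = 1` it is the edge ideal `I(G)`. -/
def edgeIdealSqfreePower (K : Type*) [Field K] {V : Type*} (G : SimpleGraph V) (k : ℕ) :
    Ideal (MvPolynomial V K) :=
  Ideal.span {p | ∃ M : Finset (Sym2 V), IsKMatching G k M ∧ p = ∏ v ∈ matchingVertices M, X v}

/-- The vector `f` is homogeneous of degree `n` in the graded free module `⊕_b S(-deg b)`, whose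
basis vector `e_b` has degree `deg b`: every monomial `m` occurring in the coordinate `f b`
satisfies `|m| + deg b = n`. -/
def IsHomogeneousVector {K σ : Type*} [Field K] {r : ℕ} (deg : Fin r → ℕ) (n : ℕ)
    (f : Fin r → MvPolynomial σ K) : Prop :=
  ∀ b, ∀ m ∈ (f b).support, m.degree + deg b = n

/-- A minimal graded free resolution
`⋯ → F₂ → F₁ → F₀ → I → 0`, `F_i = ⊕_a S(-deg i a)`, of an ideal `I` of the standard graded
polynomial ring `S = K[x_s : s ∈ σ]`. The augmentation is written as a map `F₀ → S` with
image `I`. -/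
structure MinimalGradedFreeResolution {K σ : Type*} [Field K] (I : Ideal (MvPolynomial σ K)) where
  /-- the rank of `F_i` -/
  rank : ℕ → ℕ
  /-- the degrees of the basis vectors of `F_i` -/
  deg : ∀ i, Fin (rank i) → ℕ
  /-- the augmentation -/
  aug : (Fin (rank 0) → MvPolynomial σ K) →ₗ[MvPolynomial σ K] MvPolynomial σ K
  /-- the differential `F_{i+1} → F_i` -/
  d : ∀ i, (Fin (rank (i + 1)) → MvPolynomial σ K) →ₗ[MvPolynomial σ K]
    (Fin (rank i) → MvPolynomial σ K)
  /-- the augmentation is homogeneous of degree `0` -/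
  aug_homogeneous : ∀ a, (aug (Pi.single a 1)).IsHomogeneous (deg 0 a)
  /-- the differentials are homogeneous of degree `0` -/
  d_homogeneous : ∀ i a, IsHomogeneousVector (deg i) (deg (i + 1) a) (d i (Pi.single a 1))
  range_aug : LinearMap.range aug = I
  exact_zero : Function.Exact (d 0) aug
  exact_succ : ∀ i, Function.Exact (d (i + 1)) (d i)
  /-- minimality: `d(F_{i+1}) ⊆ 𝔪 F_i`, where `𝔪` is the ideal generated by the variables -/
  minimal : ∀ i f b, d i f b ∈ Ideal.span (Set.range (X : σ → MvPolynomial σ K))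

/-- The graded Betti number `β_{i,j}` read off from a minimal graded free resolution: the number
of basis vectors of degree `j` in `F_i`, i.e. the number of copies of `S(-j)` in `F_i`. -/
def MinimalGradedFreeResolution.betti {K σ : Type*} [Field K] {I : Ideal (MvPolynomial σ K)}
    (F : MinimalGradedFreeResolution I) (i j : ℕ) : ℕ :=
  (Finset.univ.filter fun a : Fin (F.rank i) => F.deg i a = j).card

end

/-! A graded Betti number `β_{i,j}` of an ideal `I` is the dimension of the degree `j` part of the
`i`-th Koszul homology of `I` (`MinimalGradedFreeResolution.betti_eq`), a description that does not
mention a resolution. For a monomial ideal the Koszul complex splits by multidegree `a` into chain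
complexes of the families of sets `F` with `x^a / x_F` in the ideal (`hdim_koszulStrand_edgeIdeal`).
It therefore suffices that the homology of these families has the same dimensions over every field.
If some exponent of `a` is at least 2, the family is a cone. Otherwise `a` is squarefree with
support `W`, and the family consists of the `F ⊆ W` whose complement in `W` contains a `k`-matching;
for nonempty `W` the full simplex is acyclic, so one may pass to the complementary `nonMatchFamily`.

The combinatorial core is `sameHomology_nonMatchFamily`, an induction on `W`. An isolated vertex
gives a cone. Otherwise the forest has a leaf `x` whose neighbour `y` has at most one non-leaf
neighbour `z`. A second leaf at `y` allows `x` to be deleted. If there is none, the homology is a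
shift of that of `criticalFamily`, which is either a level family on `W \ {x, y}`, or a critical
family at `z` together with a level family on `W \ {x, y, z}` joined to `z`, with no connecting map.
The homology of a level family is a sum of homologies of two `nonMatchFamily`s
(`familyH_levelFamily`), because the map between those factors through a cone.

In each long exact sequence used here some map vanishes for a combinatorial reason, so dimensions
simply shift or add, and the field never enters.

Existence of resolutions comes from iterating minimal homogeneous generating sets
(`exists_minimal_cover`). -/

noncomputable section

/-! ### Lengths of subquotients, with values in `ℕ∞` -/

/-- The length of the subquotient `B / A`. -/
def qlen {K E : Type*} [Field K] [AddCommGroup E] [Module K E] (A B : Submodule K E) : ℕ∞ :=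
  Module.length K (B ⧸ A.comap B.subtype)

section qlen

variable {K E E' : Type*} [Field K] [AddCommGroup E] [Module K E] [AddCommGroup E'] [Module K E']

theorem qlen_eq_zero {A B : Submodule K E} (h : B ≤ A) : qlen A B = 0 := by
  rw [qlen, Module.length_eq_zero_iff, Submodule.Quotient.subsingleton_iff,
    Submodule.comap_subtype_eq_top]
  exact h

theorem qlen_add {A B C : Submodule K E} (hAB : A ≤ B) (hBC : B ≤ C) :
    qlen A C = qlen A B + qlen B C := by
  refine Module.length_eq_add_of_exact
    (Submodule.mapQ (A.comap B.subtype) (A.comap C.subtype) (Submodule.inclusion hBC)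
      fun x hx => hx)
    (Submodule.mapQ (A.comap C.subtype) (B.comap C.subtype) LinearMap.id
      fun x hx => hAB hx) ?_ ?_ ?_
  · rw [injective_iff_map_eq_zero]
    intro x
    obtain ⟨x, rfl⟩ := Submodule.mkQ_surjective _ x
    intro hx
    exact (Submodule.Quotient.mk_eq_zero (A.comap B.subtype)).2
      ((Submodule.Quotient.mk_eq_zero (A.comap C.subtype)).1 hx)
  · intro x
    obtain ⟨x, rfl⟩ := Submodule.mkQ_surjective _ x
    exact ⟨Submodule.Quotient.mk x, rfl⟩
  · intro x
    obtain ⟨x, rfl⟩ := Submodule.mkQ_surjective _ x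
    constructor
    · intro hx
      exact ⟨Submodule.Quotient.mk
        ⟨x, (Submodule.Quotient.mk_eq_zero (B.comap C.subtype)).1 hx⟩, rfl⟩
    · rintro ⟨y, hy⟩
      obtain ⟨y, rfl⟩ := Submodule.mkQ_surjective _ y
      rw [← hy]
      exact (Submodule.Quotient.mk_eq_zero _).2 y.2

/-- The map `f` induces an isomorphism of the two subquotients; only its behaviour on `B` matters,
so it may be an arbitrary linear map of the ambient spaces. -/
theorem qlen_congr {A B : Submodule K E} {A' B' : Submodule K E'} (f : E →ₗ[K] E')
    (hB : ∀ x ∈ B, f x ∈ B') (hsurj : ∀ y ∈ B', ∃ x ∈ B, f x = y)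
    (hker : ∀ x ∈ B, f x ∈ A' ↔ x ∈ A) : qlen A B = qlen A' B' := by
  refine LinearEquiv.length_eq (LinearEquiv.ofBijective
    (Submodule.mapQ (A.comap B.subtype) (A'.comap B'.subtype) (f.restrict hB)
      fun x hx => (hker x x.2).2 hx) ⟨?_, ?_⟩)
  · rw [injective_iff_map_eq_zero]
    intro x
    obtain ⟨x, rfl⟩ := Submodule.mkQ_surjective _ x
    intro hx
    exact (Submodule.Quotient.mk_eq_zero (A.comap B.subtype)).2
      ((hker x x.2).1 ((Submodule.Quotient.mk_eq_zero (A'.comap B'.subtype)).1 hx))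
  · intro y
    obtain ⟨⟨y, hy⟩, rfl⟩ := Submodule.mkQ_surjective _ y
    obtain ⟨x, hx, rfl⟩ := hsurj y hy
    exact ⟨Submodule.Quotient.mk ⟨x, hx⟩, rfl⟩

theorem qlen_sup (U W : Submodule K E) : qlen U (U ⊔ W) = qlen (U ⊓ W) W := by
  rw [sup_comm, inf_comm]
  exact (LinearMap.quotientInfEquivSupQuotient W U).length_eq.symm

theorem qlen_bot_top : qlen (⊥ : Submodule K E) ⊤ = Module.length K E :=
  ((Submodule.quotEquivOfEqBot _ (by simp)).trans Submodule.topEquiv).length_eq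

end qlen

/-! ### Complexes of subspaces and the long exact homology sequence -/

/-- A chain complex whose terms `C p` are subspaces of a vector space `E`. -/
structure SubspaceComplex (K E : Type*) [Field K] [AddCommGroup E] [Module K E] where
  /-- the term in degree `p` -/
  C : ℤ → Submodule K E
  /-- the differential -/
  D : E →ₗ[K] E
  D_mem : ∀ p x, x ∈ C (p + 1) → D x ∈ C p
  D_D : ∀ p x, x ∈ C p → D (D x) = 0

namespace SubspaceComplex

variable {K E E₁ E₂ E₃ : Type*} [Field K] [AddCommGroup E] [Module K E]
  [AddCommGroup E₁] [Module K E₁] [AddCommGroup E₂] [Module K E₂] [AddCommGroup E₃] [Module K E₃]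

/-- cycles -/
def Z (c : SubspaceComplex K E) (p : ℤ) : Submodule K E := c.C p ⊓ LinearMap.ker c.D

/-- boundaries -/
def B (c : SubspaceComplex K E) (p : ℤ) : Submodule K E := (c.C (p + 1)).map c.D

/-- the dimension of the homology in degree `p` -/
def hdim (c : SubspaceComplex K E) (p : ℤ) : ℕ∞ := qlen (c.B p) (c.Z p)

theorem mem_Z {c : SubspaceComplex K E} {p : ℤ} {x : E} : x ∈ c.Z p ↔ x ∈ c.C p ∧ c.D x = 0 :=
  Iff.rfl

theorem B_le_Z (c : SubspaceComplex K E) (p : ℤ) : c.B p ≤ c.Z p := by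
  rintro _ ⟨y, hy, rfl⟩
  exact ⟨c.D_mem p y hy, c.D_D _ y hy⟩

theorem hdim_eq_zero {c : SubspaceComplex K E} {p : ℤ}
    (h : ∀ x ∈ c.C p, c.D x = 0 → ∃ y ∈ c.C (p + 1), c.D y = x) : c.hdim p = 0 :=
  qlen_eq_zero fun x hx => h x hx.1 hx.2

/-- A short exact sequence `0 → c₁ → c₂ → c₃ → 0` of complexes. -/
structure IsShortExact (c₁ : SubspaceComplex K E₁) (c₂ : SubspaceComplex K E₂)
    (c₃ : SubspaceComplex K E₃) (φ : E₁ →ₗ[K] E₂) (ψ : E₂ →ₗ[K] E₃) : Prop where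
  φ_mem : ∀ p, ∀ x ∈ c₁.C p, φ x ∈ c₂.C p
  ψ_mem : ∀ p, ∀ x ∈ c₂.C p, ψ x ∈ c₃.C p
  φ_D : ∀ p, ∀ x ∈ c₁.C p, φ (c₁.D x) = c₂.D (φ x)
  ψ_D : ∀ p, ∀ x ∈ c₂.C p, ψ (c₂.D x) = c₃.D (ψ x)
  inj : ∀ p, ∀ x ∈ c₁.C p, φ x = 0 → x = 0
  zero : ∀ p, ∀ x ∈ c₁.C p, ψ (φ x) = 0
  exact : ∀ p, ∀ x ∈ c₂.C p, ψ x = 0 → ∃ y ∈ c₁.C p, φ y = x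
  surj : ∀ p, ∀ x ∈ c₃.C p, ∃ y ∈ c₂.C p, ψ y = x

/-- The dimensions in the long exact homology sequence, where `r`, `s`, `t` are the ranks of
`H(c₁) → H(c₂)`, of `H(c₂) → H(c₃)` and of the connecting map. -/
theorem IsShortExact.exists_ranks {c₁ : SubspaceComplex K E₁} {c₂ : SubspaceComplex K E₂}
    {c₃ : SubspaceComplex K E₃} {φ : E₁ →ₗ[K] E₂} {ψ : E₂ →ₗ[K] E₃}
    (S : IsShortExact c₁ c₂ c₃ φ ψ) : ∃ r s t : ℤ → ℕ∞,
      (∀ p, c₁.hdim p = t (p + 1) + r p) ∧ (∀ p, c₂.hdim p = r p + s p) ∧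
      (∀ p, c₃.hdim p = s p + t p) ∧
      (∀ p, (∀ x ∈ c₁.C p, c₁.D x = 0 → ∃ y ∈ c₂.C (p + 1), c₂.D y = φ x) → r p = 0) ∧
      (∀ p, (∀ x ∈ c₂.C p, c₂.D x = 0 → ∃ y ∈ c₃.C (p + 1), c₃.D y = ψ x) → s p = 0) ∧
      (∀ p, (∀ x ∈ c₃.C p, c₃.D x = 0 → ∃ y ∈ c₂.C p, c₂.D y = 0 ∧ ψ y = x) → t p = 0) := by
  have hφZ : ∀ p, ∀ x ∈ c₁.Z p, φ x ∈ c₂.Z p := fun p x hx =>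
    ⟨S.φ_mem p x hx.1, by
      have := S.φ_D p x hx.1
      rw [mem_Z.1 hx |>.2, map_zero] at this
      exact this.symm⟩
  have hψZ : ∀ p, ∀ x ∈ c₂.Z p, ψ x ∈ c₃.Z p := fun p x hx =>
    ⟨S.ψ_mem p x hx.1, by
      have := S.ψ_D p x hx.1
      rw [mem_Z.1 hx |>.2, map_zero] at this
      exact this.symm⟩
  have hφB : ∀ p, ∀ x ∈ c₁.B p, φ x ∈ c₂.B p := by
    rintro p _ ⟨y, hy, rfl⟩
    exact ⟨φ y, S.φ_mem _ y hy, (S.φ_D _ y hy).symm⟩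
  have hinj : ∀ p, ∀ x ∈ c₁.C p, ∀ y ∈ c₁.C p, φ x = φ y → x = y := by
    intro p x hx y hy h
    exact sub_eq_zero.1 (S.inj p _ (sub_mem hx hy) (by rw [map_sub, h, sub_self]))
  -- Cycles of `c₁` that become boundaries in `c₂`: the kernel of `H(c₁) → H(c₂)` is `R p` modulo
  -- boundaries.
  let R : ℤ → Submodule K E₁ := fun p => c₁.Z p ⊓ (c₂.B p).comap φ
  have hBR : ∀ p, c₁.B p ≤ R p := fun p x hx => ⟨c₁.B_le_Z p hx, hφB p x hx⟩
  have hφZ' : ∀ p, (c₁.Z p).map φ ≤ c₂.Z p := by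
    rintro p _ ⟨x, hx, rfl⟩; exact hφZ p x hx
  have hψZ' : ∀ p, (c₂.Z p).map ψ ≤ c₃.Z p := by
    rintro p _ ⟨x, hx, rfl⟩; exact hψZ p x hx
  refine ⟨fun p => qlen (R p) (c₁.Z p), fun p => qlen (c₂.B p ⊔ (c₁.Z p).map φ) (c₂.Z p),
    fun p => qlen ((c₂.Z p).map ψ) (c₃.Z p), fun p => ?_, fun p => ?_, fun p => ?_,
    fun p h => ?_, fun p h => ?_, fun p h => ?_⟩
  · rw [hdim, qlen_add (hBR p) inf_le_left]
    congr 1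
    -- The connecting map as a zigzag: `Y` consists of the chains of `c₂` whose boundary comes from
    -- `c₁`. Modulo `A`, the map `ψ` identifies `Y` with the cokernel of `H(c₂) → H(c₃)`, and the
    -- differential identifies it with the kernel of `H(c₁) → H(c₂)` one degree lower.
    let A : Submodule K E₂ := c₂.Z (p + 1) ⊔ (c₁.C (p + 1)).map φ
    let Y : Submodule K E₂ := c₂.C (p + 1) ⊓ ((c₁.C p).map φ).comap c₂.D
    have h1 : qlen A Y = qlen ((c₂.Z (p + 1)).map ψ) (c₃.Z (p + 1)) := by
      refine qlen_congr ψ ?_ ?_ ?_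
      · rintro y ⟨hy, a, ha, hay⟩
        refine ⟨S.ψ_mem _ y hy, ?_⟩
        change c₃.D (ψ y) = 0
        rw [← S.ψ_D _ y hy, ← hay, S.zero p a ha]
      · rintro z ⟨hz, hz0⟩
        obtain ⟨y, hy, rfl⟩ := S.surj _ z hz
        refine ⟨y, ⟨hy, ?_⟩, rfl⟩
        obtain ⟨a, ha, hay⟩ := S.exact p _ (c₂.D_mem p y hy) (by rw [S.ψ_D _ y hy]; exact hz0)
        exact ⟨a, ha, hay⟩
      · rintro y ⟨hy, -⟩
        constructor
        · rintro ⟨z, hz, hzy⟩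
          obtain ⟨a, ha, hay⟩ := S.exact _ _ (sub_mem hy hz.1) (by rw [map_sub, hzy, sub_self])
          rw [show y = z + φ a by rw [hay]; abel]
          exact Submodule.add_mem_sup hz ⟨a, ha, rfl⟩
        · intro h
          obtain ⟨z, hz, _, ⟨a, ha, rfl⟩, rfl⟩ := Submodule.mem_sup.1 h
          exact ⟨z, hz, by rw [map_add, S.zero _ a ha, add_zero]⟩
    have h2 : qlen A Y = qlen ((c₁.B p).map φ) ((R p).map φ) := by
      refine qlen_congr c₂.D ?_ ?_ ?_
      · rintro y ⟨hy, a, ha, hay⟩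
        refine ⟨a, ⟨⟨ha, ?_⟩, y, hy, hay.symm⟩, hay⟩
        refine S.inj (p - 1) _ (c₁.D_mem (p - 1) a (by simpa using ha)) ?_
        rw [S.φ_D _ a ha, hay, c₂.D_D _ y hy]
      · rintro _ ⟨a, ⟨ha, y, hy, hay⟩, rfl⟩
        exact ⟨y, ⟨hy, a, ha.1, hay.symm⟩, hay⟩
      · rintro y ⟨hy, -⟩
        constructor
        · rintro ⟨_, ⟨a, ha, rfl⟩, hay⟩
          rw [show y = (y - φ a) + φ a by abel]
          refine Submodule.add_mem_sup ⟨sub_mem hy (S.φ_mem _ a ha), ?_⟩ ⟨a, ha, rfl⟩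
          change c₂.D (y - φ a) = 0
          rw [map_sub, ← hay, S.φ_D _ a ha, sub_self]
        · intro h
          obtain ⟨z, hz, _, ⟨a, ha, rfl⟩, rfl⟩ := Submodule.mem_sup.1 h
          refine ⟨_, ⟨a, ha, rfl⟩, ?_⟩
          rw [map_add, (mem_Z.1 hz).2, zero_add, S.φ_D _ a ha]
    refine Eq.trans ?_ (h2.symm.trans h1)
    refine qlen_congr φ (fun x hx => ⟨x, hx, rfl⟩) (fun y hy => hy) ?_
    rintro x ⟨hx, -⟩
    refine ⟨?_, fun h => ⟨x, h, rfl⟩⟩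
    rintro ⟨y, hy, hyx⟩
    rwa [← hinj p y (c₁.B_le_Z p hy).1 x hx.1 hyx]
  · rw [hdim, qlen_add (B := c₂.B p ⊔ (c₁.Z p).map φ) le_sup_left
      (sup_le (c₂.B_le_Z p) (hφZ' p))]
    congr 1
    rw [qlen_sup]
    symm
    refine qlen_congr φ (fun x hx => ⟨x, hx, rfl⟩) (fun y hy => hy) ?_
    intro x hx
    exact ⟨fun h => ⟨hx, h.1⟩, fun h => ⟨h.2, x, hx, rfl⟩⟩
  · have hBψ : c₃.B p ≤ (c₂.Z p).map ψ := by
      rintro _ ⟨y, hy, rfl⟩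
      obtain ⟨w, hw, rfl⟩ := S.surj _ y hy
      exact ⟨c₂.D w, c₂.B_le_Z p ⟨w, hw, rfl⟩, S.ψ_D _ w hw⟩
    rw [hdim, qlen_add hBψ (hψZ' p)]
    congr 1
    symm
    refine qlen_congr ψ (fun x hx => ⟨x, hx, rfl⟩) (fun y hy => hy) ?_
    intro z hz
    constructor
    · rintro ⟨w, hw, hwz⟩
      obtain ⟨y, hy, rfl⟩ := S.surj _ w hw
      obtain ⟨a, ha, hay⟩ := S.exact p (z - c₂.D y) (sub_mem hz.1 (c₂.D_mem p y hy))
        (by rw [map_sub, S.ψ_D _ y hy, hwz, sub_self])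
      rw [show z = c₂.D y + φ a by rw [hay]; abel]
      refine Submodule.add_mem_sup ⟨y, hy, rfl⟩ ⟨a, ⟨ha, ?_⟩, rfl⟩
      refine S.inj (p - 1) _ (c₁.D_mem (p - 1) a (by simpa using ha)) ?_
      rw [S.φ_D _ a ha, hay, map_sub, (mem_Z.1 hz).2, c₂.D_D _ y hy, sub_self]
    · intro h
      obtain ⟨_, ⟨y, hy, rfl⟩, _, ⟨a, ha, rfl⟩, rfl⟩ := Submodule.mem_sup.1 h
      refine ⟨ψ y, S.ψ_mem _ y hy, ?_⟩
      rw [map_add, S.zero _ a ha.1, add_zero, S.ψ_D _ y hy]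
  · exact qlen_eq_zero fun x hx => ⟨hx, h x hx.1 hx.2 |>.imp fun y hy => hy⟩
  · refine qlen_eq_zero fun x hx => ?_
    obtain ⟨w, hw, hwx⟩ := h x hx.1 hx.2
    obtain ⟨y, hy, rfl⟩ := S.surj _ w hw
    obtain ⟨a, ha, hay⟩ := S.exact p (x - c₂.D y) (sub_mem hx.1 (c₂.D_mem p y hy))
      (by rw [map_sub, S.ψ_D _ y hy, hwx, sub_self])
    rw [show x = c₂.D y + φ a by rw [hay]; abel]
    refine Submodule.add_mem_sup ⟨y, hy, rfl⟩ ⟨a, ⟨ha, ?_⟩, rfl⟩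
    refine S.inj (p - 1) _ (c₁.D_mem (p - 1) a (by simpa using ha)) ?_
    rw [S.φ_D _ a ha, hay, map_sub, (mem_Z.1 hx).2, c₂.D_D _ y hy, sub_self]
  · refine qlen_eq_zero fun x hx => ?_
    obtain ⟨y, hy, hy0, rfl⟩ := h x hx.1 hx.2
    exact ⟨y, ⟨hy, hy0⟩, rfl⟩

end SubspaceComplex


/-! ### The Koszul differential and its homotopies -/

section Koszul

variable {V : Type*} [LinearOrder V]

/-- The sign with which `v` enters the exterior monomial `e_F`. -/
def koszulSign (F : Finset V) (v : V) : ℤ := (-1) ^ (F.filter (· < v)).card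

theorem koszulSign_mul_self (F : Finset V) (v : V) : koszulSign F v * koszulSign F v = 1 := by
  rw [koszulSign, ← pow_add, Even.neg_one_pow ⟨_, rfl⟩]

theorem koszulSign_insert {F : Finset V} {w : V} (hw : w ∉ F) (v : V) :
    koszulSign (insert w F) v = (if w < v then -1 else 1) * koszulSign F v := by
  rw [koszulSign, koszulSign, Finset.filter_insert]
  split_ifs with h
  · rw [Finset.card_insert_of_notMem (by simp [hw]), pow_succ']
  · simp

theorem koszulSign_insert_self {F : Finset V} {v : V} (hv : v ∉ F) :
    koszulSign (insert v F) v = koszulSign F v := by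
  simp [koszulSign_insert hv]

theorem koszulSign_swap {F : Finset V} {v w : V} (hv : v ∉ F) (hw : w ∉ F) (h : v ≠ w) :
    koszulSign F v * koszulSign (insert v F) w = -(koszulSign F w * koszulSign (insert w F) v) := by
  rw [koszulSign_insert hv, koszulSign_insert hw]
  rcases lt_or_gt_of_ne h with h | h <;> simp [h, h.not_gt, mul_comm]

variable {K M : Type*} [Field K] [AddCommGroup M] [Module K M]

/-- Exterior multiplication by `e_v` combined with an operator `B` on `M`. -/
def koszulH (v : V) (B : M →ₗ[K] M) : (Finset V → M) →ₗ[K] (Finset V → M) :=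
  LinearMap.pi fun F =>
    if v ∈ F then koszulSign F v • (B ∘ₗ LinearMap.proj (F.erase v)) else 0

theorem koszulH_apply (v : V) (B : M →ₗ[K] M) (f : Finset V → M) (F : Finset V) :
    koszulH v B f F = if v ∈ F then koszulSign F v • B (f (F.erase v)) else 0 := by
  rw [koszulH, LinearMap.pi_apply]
  split_ifs <;> rfl

variable [Fintype V]

/-- The Koszul differential on `M ⊗ Λ` for operators `A v` on `M`; the element `∑ f F ⊗ e_F` is
given by the function `f`. -/
def koszulD (A : V → M →ₗ[K] M) : (Finset V → M) →ₗ[K] (Finset V → M) :=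
  LinearMap.pi fun F => ∑ v ∈ Fᶜ, koszulSign F v • (A v ∘ₗ LinearMap.proj (insert v F))

theorem koszulD_apply (A : V → M →ₗ[K] M) (f : Finset V → M) (F : Finset V) :
    koszulD A f F = ∑ v ∈ Fᶜ, koszulSign F v • A v (f (insert v F)) := by
  simp [koszulD, LinearMap.sum_apply]

/-- Exchanging the two vertices that are removed pairs the terms off with opposite signs. -/
theorem koszulD_koszulD (A : V → M →ₗ[K] M) (hA : ∀ v w x, A v (A w x) = A w (A v x))
    (f : Finset V → M) : koszulD A (koszulD A f) = 0 := by
  funext F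
  simp only [koszulD_apply, map_sum, Finset.smul_sum, Pi.zero_apply]
  rw [Finset.sum_sigma']
  refine Finset.sum_involution (fun x _ => ⟨x.2, x.1⟩) ?_ ?_ ?_ ?_
  · rintro ⟨v, w⟩ h
    simp only [Finset.mem_sigma, Finset.mem_compl, Finset.mem_insert, not_or] at h
    simp only [map_zsmul, smul_smul, hA w v, Finset.insert_comm w v]
    rw [koszulSign_swap h.1 h.2.2 (Ne.symm h.2.1), neg_smul, neg_add_cancel]
  · rintro ⟨v, w⟩ h _ h'
    simp only [Finset.mem_sigma, Finset.mem_compl, Finset.mem_insert, not_or] at h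
    exact h.2.1 (congrArg Sigma.fst h')
  · rintro ⟨v, w⟩ h
    simp only [Finset.mem_sigma, Finset.mem_compl, Finset.mem_insert, not_or] at h ⊢
    exact ⟨h.2.2, Ne.symm h.2.1, h.1⟩
  · rintro ⟨v, w⟩ _
    rfl

/-- The terms indexed by `w ≠ v` cancel, since `B` commutes with `A w`; only the index `v` survives.
With `B = id` this contracts cones, and with `B` the division by a variable it shows that Koszul
cycles in a free module are boundaries up to constants. -/
theorem koszulD_koszulH_add (A : V → M →ₗ[K] M) (v : V) (B : M →ₗ[K] M)
    (hB : ∀ w, w ≠ v → ∀ x, A w (B x) = B (A w x)) (f : Finset V → M) (F : Finset V) :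
    koszulD A (koszulH v B f) F + koszulH v B (koszulD A f) F =
      if v ∈ F then B (A v (f F)) else A v (B (f F)) := by
  split_ifs with hv
  · obtain ⟨G, hvG, rfl⟩ : ∃ G, v ∉ G ∧ insert v G = F :=
      ⟨F.erase v, Finset.notMem_erase _ _, Finset.insert_erase hv⟩
    have hc : Gᶜ = insert v (insert v G)ᶜ := by
      ext w; by_cases h : w = v <;> simp [h, hvG]
    rw [koszulH_apply, if_pos hv, Finset.erase_insert hvG, koszulD_apply, koszulD_apply, hc,
      Finset.sum_insert (by simp), map_add, map_zsmul, smul_add, smul_smul,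
      koszulSign_insert_self hvG, koszulSign_mul_self, one_smul, map_sum, Finset.smul_sum,
      add_left_comm, ← Finset.sum_add_distrib, Finset.sum_eq_zero, add_zero]
    intro w hw
    simp only [Finset.mem_compl, Finset.mem_insert, not_or] at hw
    have hwv : w ≠ v := hw.1
    rw [koszulH_apply, if_pos (by simp), map_zsmul, map_zsmul, smul_smul, smul_smul,
      hB w hwv, Finset.erase_insert_of_ne hwv, Finset.erase_insert hvG, ← add_smul]
    convert zero_smul ℤ _
    rw [koszulSign_insert (F := insert v G) (by simp [hw]), koszulSign_insert hvG,
      koszulSign_insert_self hvG]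
    rcases lt_or_gt_of_ne hwv with h | h <;> simp [h, h.not_gt] <;> ring
  · rw [koszulH_apply, if_neg hv, add_zero, koszulD_apply, Finset.sum_eq_single v]
    · rw [koszulH_apply, if_pos (by simp), map_zsmul, smul_smul, koszulSign_insert_self hv,
        koszulSign_mul_self, one_smul, Finset.erase_insert hv]
    · intro w _ hwv
      rw [koszulH_apply, if_neg (by simp [hv, Ne.symm hwv]), map_zero, smul_zero]
    · intro h
      exact absurd (by simpa using hv) h

end Koszul


/-! ### Chain complexes of convex families of sets -/

section IsSplit

variable {V : Type*} {𝒜 𝒞 ℬ : Set (Finset V)}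

/-- `𝒞` is the disjoint union of `𝒜` and `ℬ`, where no member of `ℬ` lies in a member of `𝒜`. -/
structure IsSplit (𝒜 𝒞 ℬ : Set (Finset V)) : Prop where
  ordConnected : 𝒞.OrdConnected
  mem_iff : ∀ F, F ∈ 𝒞 ↔ F ∈ 𝒜 ∨ F ∈ ℬ
  not_subset : ∀ A ∈ 𝒜, ∀ B ∈ ℬ, ¬ B ⊆ A

theorem IsSplit.left_ordConnected (S : IsSplit 𝒜 𝒞 ℬ) : 𝒜.OrdConnected := by
  refine ⟨fun A hA B hB F hF => ?_⟩
  rcases (S.mem_iff F).1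
    (S.ordConnected.out ((S.mem_iff A).2 (.inl hA)) ((S.mem_iff B).2 (.inl hB)) hF) with h | h
  · exact h
  · exact absurd hF.2 (S.not_subset _ hB _ h)

theorem IsSplit.right_ordConnected (S : IsSplit 𝒜 𝒞 ℬ) : ℬ.OrdConnected := by
  refine ⟨fun A hA B hB F hF => ?_⟩
  rcases (S.mem_iff F).1
    (S.ordConnected.out ((S.mem_iff A).2 (.inr hA)) ((S.mem_iff B).2 (.inr hB)) hF) with h | h
  · exact absurd hF.1 (S.not_subset _ h _ hA)
  · exact h

end IsSplit

section Families

variable {V : Type*} (K : Type*) [Field K]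

open Classical in
/-- The projection of `K^(2^V)` onto the functions supported on `𝒞`. -/
def familyProj (𝒞 : Set (Finset V)) : (Finset V → K) →ₗ[K] (Finset V → K) :=
  LinearMap.pi fun F => if F ∈ 𝒞 then LinearMap.proj F else 0

variable {K} in
theorem familyProj_of_mem {𝒞 : Set (Finset V)} {F : Finset V} (h : F ∈ 𝒞) (f : Finset V → K) :
    familyProj K 𝒞 f F = f F := by
  simp [familyProj, h]

variable {K} in
theorem familyProj_of_notMem {𝒞 : Set (Finset V)} {F : Finset V} (h : F ∉ 𝒞)
    (f : Finset V → K) : familyProj K 𝒞 f F = 0 := by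
  simp [familyProj, h]

/-- Functions supported on the members of `𝒞` with `p` elements. -/
def familyChains (𝒞 : Set (Finset V)) (p : ℤ) : Submodule K (Finset V → K) where
  carrier := {f | ∀ F, f F ≠ 0 → F ∈ 𝒞 ∧ (F.card : ℤ) = p}
  zero_mem' := fun F h => absurd rfl h
  add_mem' := fun {f g} hf hg F h => by
    by_cases hfF : f F = 0
    · exact hg F fun h' => h (by simp [hfF, h'])
    · exact hf F hfF
  smul_mem' := fun c f hf F h => hf F fun h' => h (by simp [h'])

variable {K} in
theorem familyProj_mem {𝒞 𝒞' : Set (Finset V)} {p : ℤ} {f : Finset V → K}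
    (hf : f ∈ familyChains K 𝒞 p) : familyProj K 𝒞' f ∈ familyChains K 𝒞' p := by
  intro F hF
  by_cases h : F ∈ 𝒞'
  · rw [familyProj_of_mem h] at hF
    exact ⟨h, (hf F hF).2⟩
  · exact absurd (familyProj_of_notMem h f) hF

variable [LinearOrder V] [Fintype V]

/-- The boundary operator on `K^(2^V)`. -/
abbrev simplexD : (Finset V → K) →ₗ[K] (Finset V → K) :=
  koszulD fun _ => LinearMap.id

/-- The chain complex with basis a convex family `𝒞` of subsets of `V`, i.e. the relative
(augmented) simplicial chain complex of a pair of simplicial complexes with difference `𝒞`. -/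
def familyComplex (𝒞 : Set (Finset V)) (h𝒞 : 𝒞.OrdConnected) :
    SubspaceComplex K (Finset V → K) where
  C := familyChains K 𝒞
  D := familyProj K 𝒞 ∘ₗ simplexD K
  D_mem := by
    intro p f hf F hF
    by_cases h : F ∈ 𝒞
    · refine ⟨h, ?_⟩
      rw [LinearMap.comp_apply, familyProj_of_mem h, koszulD_apply] at hF
      obtain ⟨v, hv, hF⟩ := Finset.exists_ne_zero_of_sum_ne_zero hF
      have := (hf (insert v F) fun h' => hF (by simp [h'])).2
      rw [Finset.card_insert_of_notMem (by simpa using hv)] at this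
      push_cast at this
      omega
    · exact absurd (familyProj_of_notMem h _) hF
  D_D := by
    intro p f hf
    funext F
    by_cases h : F ∈ 𝒞
    · rw [LinearMap.comp_apply, familyProj_of_mem h, LinearMap.comp_apply]
      refine Eq.trans ?_ (congrFun (koszulD_koszulD (K := K) (fun _ => LinearMap.id) (by simp) f) F)
      rw [koszulD_apply, koszulD_apply _ (simplexD K f)]
      refine Finset.sum_congr rfl fun v hv => ?_
      congr 2
      -- Truncating the inner boundary to `𝒞` loses nothing: if `insert v F` is outside `𝒞`,
      -- convexity leaves no set of `𝒞` one vertex above it, so `f` contributes nothing there.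
      by_cases h' : insert v F ∈ 𝒞
      · rw [familyProj_of_mem h']
      · rw [familyProj_of_notMem h', koszulD_apply, Finset.sum_eq_zero]
        intro w hw
        by_contra hne
        have := (hf (insert w (insert v F)) fun h0 => hne (by simp [h0])).1
        exact h' (h𝒞.out h this ⟨Finset.subset_insert _ _, Finset.subset_insert _ _⟩)
    · exact familyProj_of_notMem h _

/-- The dimensions of the homology of the complex of a convex family. -/
def familyH (𝒞 : Set (Finset V)) (p : ℤ) : ℕ∞ :=
  -- A supremum over a proof of convexity keeps that proof out of later statements; the value is `0`
  -- for a family that is not convex.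
  ⨆ h : 𝒞.OrdConnected, (familyComplex K 𝒞 h).hdim p

theorem familyH_eq {𝒞 : Set (Finset V)} (h : 𝒞.OrdConnected) (p : ℤ) :
    familyH K 𝒞 p = (familyComplex K 𝒞 h).hdim p := by
  rw [familyH, iSup_pos h]

namespace IsSplit

variable {K} {𝒜 𝒞 ℬ : Set (Finset V)}

/-- No face of a member of `𝒜` lies in `ℬ`, so discarding `𝒜` commutes with the boundary. Hence `𝒜`
spans a subcomplex with quotient complex `ℬ`. -/
theorem proj_D (S : IsSplit 𝒜 𝒞 ℬ) {p : ℤ} {f : Finset V → K} (hf : f ∈ familyChains K 𝒞 p) :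
    familyProj K ℬ ((familyComplex K 𝒞 S.ordConnected).D f) =
      (familyComplex K ℬ S.right_ordConnected).D (familyProj K ℬ f) := by
  funext F
  change familyProj K ℬ (familyProj K 𝒞 (simplexD K f)) F =
    familyProj K ℬ (simplexD K (familyProj K ℬ f)) F
  by_cases h : F ∈ ℬ
  · rw [familyProj_of_mem h, familyProj_of_mem h, familyProj_of_mem ((S.mem_iff F).2 (.inr h)),
      koszulD_apply, koszulD_apply]
    refine Finset.sum_congr rfl fun v _ => ?_
    congr 2
    by_cases h' : insert v F ∈ ℬ
    · rw [familyProj_of_mem h']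
    · rw [familyProj_of_notMem h']
      by_contra hne
      rcases (S.mem_iff _).1 (hf _ hne).1 with h1 | h1
      · exact S.not_subset _ h1 _ h (Finset.subset_insert _ _)
      · exact h' h1
  · rw [familyProj_of_notMem h, familyProj_of_notMem h]

theorem isShortExact (S : IsSplit 𝒜 𝒞 ℬ) :
    SubspaceComplex.IsShortExact (familyComplex K 𝒜 S.left_ordConnected)
      (familyComplex K 𝒞 S.ordConnected) (familyComplex K ℬ S.right_ordConnected)
      LinearMap.id (familyProj K ℬ) where
  φ_mem := fun p f hf F hF => ⟨(S.mem_iff F).2 (.inl (hf F hF).1), (hf F hF).2⟩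
  ψ_mem := fun p f hf => familyProj_mem hf
  φ_D := by
    intro p f hf
    funext F
    change familyProj K 𝒜 (simplexD K f) F = familyProj K 𝒞 (simplexD K f) F
    by_cases h : F ∈ 𝒜
    · rw [familyProj_of_mem h, familyProj_of_mem ((S.mem_iff F).2 (.inl h))]
    · rw [familyProj_of_notMem h]
      by_cases h' : F ∈ 𝒞
      · rw [familyProj_of_mem h', koszulD_apply, Finset.sum_eq_zero]
        intro v hv
        by_contra hne
        have h1 := (hf (insert v F) fun h0 => hne (by simp [h0])).1
        exact S.not_subset _ h1 _ (((S.mem_iff F).1 h').resolve_left h) (Finset.subset_insert _ _)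
      · rw [familyProj_of_notMem h']
  ψ_D := fun p f hf => S.proj_D hf
  inj := fun p f _ h => h
  zero := by
    intro p f hf
    funext F
    by_cases h : F ∈ ℬ
    · rw [familyProj_of_mem h]
      by_contra hne
      exact S.not_subset _ (hf F hne).1 _ h subset_rfl
    · exact familyProj_of_notMem h f
  exact := by
    intro p f hf h
    refine ⟨f, fun F hF => ⟨?_, (hf F hF).2⟩, rfl⟩
    rcases (S.mem_iff F).1 (hf F hF).1 with h1 | h1
    · exact h1
    · exact absurd ((familyProj_of_mem h1 f).symm.trans (congrFun h F)) hF
  surj := by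
    intro p f hf
    refine ⟨f, fun F hF => ⟨(S.mem_iff F).2 (.inr (hf F hF).1), (hf F hF).2⟩, ?_⟩
    funext F
    by_cases h : F ∈ ℬ
    · rw [familyProj_of_mem h]
    · rw [familyProj_of_notMem h]
      by_contra hne
      exact h (hf F (Ne.symm hne)).1

end IsSplit

/-- Membership in `𝒞` does not depend on whether a set contains `v`. -/
def IsToggle {V : Type*} [DecidableEq V] (v : V) (𝒞 : Set (Finset V)) : Prop :=
  ∀ F, v ∉ F → (F ∈ 𝒞 ↔ insert v F ∈ 𝒞)

-- The family is a cone with apex `v`: inserting `v` is a contracting homotopy that stays inside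
-- `𝒞`.
variable {K} in
theorem IsToggle.exists_boundary {v : V} {𝒞 : Set (Finset V)} (hv : IsToggle v 𝒞)
    (h𝒞 : 𝒞.OrdConnected) {p : ℤ} {f : Finset V → K} (hf : f ∈ familyChains K 𝒞 p)
    (hD : (familyComplex K 𝒞 h𝒞).D f = 0) :
    ∃ g ∈ familyChains K 𝒞 (p + 1), (familyComplex K 𝒞 h𝒞).D g = f := by
  have key : ∀ F, simplexD K (koszulH v (LinearMap.id : K →ₗ[K] K) f) F +
      koszulH v (LinearMap.id : K →ₗ[K] K) (simplexD K f) F = f F := fun F => by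
    rw [koszulD_koszulH_add (K := K) (M := K) _ v LinearMap.id (by simp)]
    simp
  refine ⟨koszulH v (LinearMap.id : K →ₗ[K] K) f, ?_, ?_⟩
  · intro F hF
    rw [koszulH_apply] at hF
    split_ifs at hF with hvF
    · obtain ⟨h1, h2⟩ := hf (F.erase v) fun h0 => hF (by simp [h0])
      rw [hv _ (Finset.notMem_erase v F), Finset.insert_erase hvF] at h1
      refine ⟨h1, ?_⟩
      rw [← h2, ← Finset.card_erase_add_one hvF]
      push_cast
      rfl
    · exact absurd rfl hF
  · funext F
    change familyProj K 𝒞 (simplexD K (koszulH v (LinearMap.id : K →ₗ[K] K) f)) F = f F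
    by_cases h : F ∈ 𝒞
    · rw [familyProj_of_mem h, ← key F, left_eq_add, koszulH_apply]
      split_ifs with hvF
      · have h1 : F.erase v ∈ 𝒞 := by
          rwa [hv _ (Finset.notMem_erase v F), Finset.insert_erase hvF]
        have h2 : simplexD K f (F.erase v) = 0 := by
          rw [← familyProj_of_mem h1 (simplexD K f)]
          exact congrFun hD _
        rw [h2, map_zero, smul_zero]
      · rfl
    · rw [familyProj_of_notMem h]
      by_contra hne
      exact h (hf F (Ne.symm hne)).1

theorem familyH_of_toggle {v : V} {𝒞 : Set (Finset V)} (hv : IsToggle v 𝒞)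
    (h𝒞 : 𝒞.OrdConnected) (p : ℤ) : familyH K 𝒞 p = 0 := by
  rw [familyH_eq K h𝒞]
  exact SubspaceComplex.hdim_eq_zero fun f hf hD => hv.exists_boundary h𝒞 hf hD

theorem familyH_empty (p : ℤ) : familyH K (∅ : Set (Finset V)) p = 0 := by
  rw [familyH_eq K Set.ordConnected_empty]
  refine SubspaceComplex.hdim_eq_zero fun f hf _ => ⟨0, zero_mem _, ?_⟩
  rw [map_zero]
  funext F
  by_contra hne
  exact (hf F (Ne.symm hne)).1

namespace IsSplit

variable {𝒜 𝒞 ℬ : Set (Finset V)}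

/-- Here and in the next two lemmas one of the three complexes is acyclic, which makes the long
exact sequence an isomorphism between the homologies of the other two. -/
theorem familyH_of_left {v : V} (S : IsSplit 𝒜 𝒞 ℬ) (hv : IsToggle v 𝒜) (p : ℤ) :
    familyH K 𝒞 p = familyH K ℬ p := by
  obtain ⟨r, s, t, h1, h2, h3, -, -, -⟩ := (S.isShortExact (K := K)).exists_ranks
  have h0 : ∀ p, t (p + 1) = 0 ∧ r p = 0 := fun p => by
    rw [← add_eq_zero, ← h1, ← familyH_eq]
    exact familyH_of_toggle K hv S.left_ordConnected p
  have ht : t p = 0 := by simpa using (h0 (p - 1)).1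
  rw [familyH_eq K S.ordConnected, familyH_eq K S.right_ordConnected, h2, h3, ht, (h0 p).2,
    zero_add, add_zero]

theorem familyH_of_right {v : V} (S : IsSplit 𝒜 𝒞 ℬ) (hv : IsToggle v ℬ) (p : ℤ) :
    familyH K 𝒞 p = familyH K 𝒜 p := by
  obtain ⟨r, s, t, h1, h2, h3, -, -, -⟩ := (S.isShortExact (K := K)).exists_ranks
  have h0 : ∀ p, s p = 0 ∧ t p = 0 := fun p => by
    rw [← add_eq_zero, ← h3, ← familyH_eq]
    exact familyH_of_toggle K hv S.right_ordConnected p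
  rw [familyH_eq K S.ordConnected, familyH_eq K S.left_ordConnected, h1, h2, (h0 p).1,
    (h0 (p + 1)).2, zero_add, add_zero]

theorem familyH_of_middle {v : V} (S : IsSplit 𝒜 𝒞 ℬ) (hv : IsToggle v 𝒞) (p : ℤ) :
    familyH K ℬ (p + 1) = familyH K 𝒜 p := by
  obtain ⟨r, s, t, h1, h2, h3, -, -, -⟩ := (S.isShortExact (K := K)).exists_ranks
  have h0 : ∀ p, r p = 0 ∧ s p = 0 := fun p => by
    rw [← add_eq_zero, ← h2, ← familyH_eq]
    exact familyH_of_toggle K hv S.ordConnected p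
  rw [familyH_eq K S.right_ordConnected, familyH_eq K S.left_ordConnected, h1, h3, (h0 p).1,
    (h0 (p + 1)).2, zero_add, add_zero]

/-- A cycle supported on `ℬ` has no boundary terms in `𝒜`, so it is already a cycle in `𝒞`, and the
connecting map is zero. -/
theorem familyH_of_disconnected (S : IsSplit 𝒜 𝒞 ℬ)
    (h : ∀ F ∈ 𝒜, ∀ v, insert v F ∉ ℬ) (p : ℤ) :
    familyH K 𝒞 p = familyH K 𝒜 p + familyH K ℬ p := by
  obtain ⟨r, s, t, h1, h2, h3, -, -, h6⟩ := (S.isShortExact (K := K)).exists_ranks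
  have ht : ∀ p, t p = 0 := by
    refine fun p => h6 p fun f hf hD => ?_
    have hf' : f ∈ familyChains K 𝒞 p :=
      fun F hF => ⟨(S.mem_iff F).2 (.inr (hf F hF).1), (hf F hF).2⟩
    have hPf : familyProj K ℬ f = f := by
      funext F
      by_cases hF : F ∈ ℬ
      · exact familyProj_of_mem hF f
      · rw [familyProj_of_notMem hF]
        by_contra hne
        exact hF (hf F (Ne.symm hne)).1
    refine ⟨f, hf', ?_, hPf⟩
    funext F
    change familyProj K 𝒞 (simplexD K f) F = 0
    by_cases hF : F ∈ 𝒞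
    · rcases (S.mem_iff F).1 hF with hA | hB
      · rw [familyProj_of_mem hF, koszulD_apply, Finset.sum_eq_zero]
        intro v _
        by_contra hne
        exact h F hA v (hf (insert v F) fun h0 => hne (by simp [h0])).1
      · rw [familyProj_of_mem hF, ← familyProj_of_mem hB (simplexD K f)]
        exact congrFun hD F
    · exact familyProj_of_notMem hF _
  rw [familyH_eq K S.ordConnected, familyH_eq K S.left_ordConnected,
    familyH_eq K S.right_ordConnected, h1, h2, h3, ht, ht, zero_add, add_zero]

/-- If the map `H(𝒞) → H(ℬ)` factors through an acyclic complex, the long exact sequence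
splits. -/
theorem familyH_of_factor {v : V} {ℳ 𝒜₁ 𝒜₂ : Set (Finset V)} (S : IsSplit 𝒜 𝒞 ℬ)
    (S₁ : IsSplit 𝒜₁ 𝒞 ℳ) (S₂ : IsSplit 𝒜₂ ℳ ℬ) (hv : IsToggle v ℳ) (p : ℤ) :
    familyH K 𝒜 p = familyH K 𝒞 p + familyH K ℬ (p + 1) := by
  obtain ⟨r, s, t, h1, h2, h3, -, h5, -⟩ := (S.isShortExact (K := K)).exists_ranks
  have hs : ∀ p, s p = 0 := by
    refine fun p => h5 p fun f hf hD => ?_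
    have hD' : (familyComplex K ℳ S₂.ordConnected).D (familyProj K ℳ f) = 0 := by
      rw [← S₁.proj_D hf]
      exact (congrArg (familyProj K ℳ) hD).trans (map_zero _)
    -- The image of `f` in the acyclic middle complex bounds; projecting the bounding chain to `ℬ`
    -- shows that the image of `f` in `H(ℬ)` vanishes.
    obtain ⟨g, hg, hgf⟩ := hv.exists_boundary S₂.ordConnected (familyProj_mem hf) hD'
    refine ⟨familyProj K ℬ g, familyProj_mem hg, ?_⟩
    rw [← S₂.proj_D hg, hgf]
    funext F
    by_cases hF : F ∈ ℬ
    · rw [familyProj_of_mem hF, familyProj_of_mem hF,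
        familyProj_of_mem ((S₂.mem_iff F).2 (.inr hF))]
    · rw [familyProj_of_notMem hF, familyProj_of_notMem hF]
  rw [familyH_eq K S.ordConnected, familyH_eq K S.left_ordConnected,
    familyH_eq K S.right_ordConnected, h1, h2, h3, hs, hs, zero_add, add_zero, add_comm]

end IsSplit

/-- Joining a new vertex `x` to all members of a family shifts homology. -/
theorem familyH_insert {x : V} {𝒜 : Set (Finset V)} (h𝒜 : 𝒜.OrdConnected)
    (hx : ∀ F ∈ 𝒜, x ∉ F) (p : ℤ) :
    familyH K {F | x ∈ F ∧ F.erase x ∈ 𝒜} (p + 1) = familyH K 𝒜 p := by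
  -- The middle term is the cone over `𝒜` with apex `x`.
  have S : IsSplit 𝒜 {F | F.erase x ∈ 𝒜} {F | x ∈ F ∧ F.erase x ∈ 𝒜} := by
    refine ⟨⟨fun A hA B hB F hF => h𝒜.out hA hB
      ⟨Finset.erase_subset_erase x hF.1, Finset.erase_subset_erase x hF.2⟩⟩, fun F => ?_,
      fun A hA B hB hBA => hx A hA (hBA hB.1)⟩
    by_cases hxF : x ∈ F
    · simpa [hxF] using fun h => absurd hxF (hx F h)
    · simp [hxF]
  exact S.familyH_of_middle K (v := x) (fun F hF => by
    rw [Set.mem_ofPred_eq, Set.mem_ofPred_eq, Finset.erase_insert_eq_erase]) p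

end Families


/-! ### Matchings and leaves in forests -/

section Matchings

variable {V : Type*} [DecidableEq V] (G : SimpleGraph V)

/-- There are `k` pairwise disjoint edges of `G` inside `U`. -/
def HasMatching : ℕ → Finset V → Prop
  | 0, _ => True
  | k + 1, U => ∃ a b, a ∈ U ∧ b ∈ U ∧ G.Adj a b ∧ HasMatching k (U \ {a, b})

variable {G}

theorem HasMatching.mono {k : ℕ} {U U' : Finset V} (h : HasMatching G k U) (hU : U ⊆ U') :
    HasMatching G k U' := by
  induction k generalizing U U' with
  | zero => trivial
  | succ k ih =>
    obtain ⟨a, b, ha, hb, hab, h⟩ := h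
    exact ⟨a, b, hU ha, hU hb, hab, ih h (Finset.sdiff_subset_sdiff hU subset_rfl)⟩

/-- A vertex lies on at most one edge of a matching. -/
theorem HasMatching.erase {k : ℕ} {U : Finset V} (h : HasMatching G (k + 1) U) (v : V) :
    HasMatching G k (U.erase v) := by
  induction k generalizing U with
  | zero => trivial
  | succ k ih =>
    obtain ⟨a, b, ha, hb, hab, h⟩ := h
    by_cases hv : v = a ∨ v = b
    · exact h.mono (by grind)
    · exact ⟨a, b, by grind, by grind, hab, (ih h).mono (by grind)⟩

theorem HasMatching.pred {k : ℕ} {U : Finset V} (h : HasMatching G (k + 1) U) :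
    HasMatching G k U := by
  induction k generalizing U with
  | zero => trivial
  | succ k ih =>
    obtain ⟨a, b, ha, hb, hab, h⟩ := h
    exact ⟨a, b, ha, hb, hab, ih h⟩

theorem hasMatching_erase_iff {k : ℕ} {U : Finset V} {v : V} (hv : ∀ w ∈ U, ¬ G.Adj v w) :
    HasMatching G k (U.erase v) ↔ HasMatching G k U := by
  refine ⟨fun h => h.mono (Finset.erase_subset _ _), fun h => ?_⟩
  induction k generalizing U with
  | zero => trivial
  | succ k ih =>
    obtain ⟨a, b, ha, hb, hab, h⟩ := h
    have hva : a ≠ v := by rintro rfl; exact hv b hb hab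
    have hvb : b ≠ v := by rintro rfl; exact hv a ha hab.symm
    refine ⟨a, b, by grind, by grind, hab, (ih ?_ h).mono (by grind)⟩
    exact fun w hw => hv w (by grind)

/-- The leaf edge can be assumed to belong to the matching: an edge of the matching at `y` may be
exchanged for it. -/
theorem hasMatching_leaf_iff {k : ℕ} {U : Finset V} {x y : V} (hx : x ∈ U) (hy : y ∈ U)
    (hxy : G.Adj x y) (hleaf : ∀ w ∈ U, G.Adj x w → w = y) :
    HasMatching G (k + 1) U ↔ HasMatching G k (U \ {x, y}) := by
  refine ⟨fun h => ?_, fun h => ⟨x, y, hx, hy, hxy, h⟩⟩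
  induction k generalizing U with
  | zero => trivial
  | succ k ih =>
    obtain ⟨a, b, ha, hb, hab, h⟩ := h
    by_cases hyab : y = a ∨ y = b
    · have : HasMatching G (k + 1) ((U \ {a, b}).erase x) := by
        refine (hasMatching_erase_iff fun w hw hxw => ?_).2 h
        have := hleaf w (by grind) hxw
        grind
      exact this.mono (by grind)
    · have hxa : x ≠ a := by rintro rfl; exact hyab (.inr (hleaf b hb hab).symm)
      have hxb : x ≠ b := by rintro rfl; exact hyab (.inl (hleaf a ha hab.symm).symm)
      have := ih (U := U \ {a, b}) (by grind) (by grind) (fun w hw => hleaf w (by grind)) h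
      exact ⟨a, b, by grind, by grind, hab, this.mono (by grind)⟩

/-- A matching covers at most one of two leaves at the same vertex, and that one can be taken to be
`x`. -/
theorem hasMatching_twin_iff {k : ℕ} {U : Finset V} {x x' y : V} (hx : x ∈ U) (hxx' : x ≠ x')
    (hxy : G.Adj x y) (hleaf : ∀ w ∈ U, G.Adj x w → w = y)
    (hleaf' : ∀ w ∈ U, G.Adj x' w → w = y) :
    HasMatching G k (U.erase x') ↔ HasMatching G k U := by
  refine ⟨fun h => h.mono (Finset.erase_subset _ _), fun h => ?_⟩
  by_cases hy : y ∈ U.erase x'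
  · cases k with
    | zero => trivial
    | succ k =>
      rw [hasMatching_leaf_iff hx (Finset.mem_of_mem_erase hy) hxy hleaf] at h
      rw [hasMatching_leaf_iff (by grind) hy hxy fun w hw => hleaf w (by grind)]
      rw [← hasMatching_erase_iff (v := x')] at h
      · exact h.mono (by grind)
      · intro w hw hw'
        have := hleaf' w (by grind) hw'
        grind
  · refine (hasMatching_erase_iff fun w hw hw' => ?_).2 h
    have := hleaf' w hw hw'
    subst this
    have : w = x' := by grind
    exact hw'.ne this.symm

/-- Take the end `v` of a longest path. By maximality all neighbours of `v` lie on the path, and by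
acyclicity only the penultimate vertex can be one. -/
theorem SimpleGraph.IsAcyclic.exists_unique_neighbor (hG : G.IsAcyclic) {W : Finset V}
    (hW : W.Nonempty) : ∃ v ∈ W, ∃ z, ∀ w ∈ W, G.Adj v w → w = z := by
  let H := G.induce (W : Set V)
  have hH : H.IsAcyclic := hG.induce _
  have : Nonempty (W : Set V) := hW.to_subtype
  obtain ⟨u, v, p, hp, hmax⟩ :=
    SimpleGraph.Walk.exists_isPath_forall_isPath_length_le_length H
  refine ⟨v, v.2, p.penultimate, fun w hw hvw => ?_⟩
  have hadj : H.Adj v ⟨w, hw⟩ := hvw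
  have hs : (⟨w, hw⟩ : (W : Set V)) ∈ p.support := by
    by_contra hs
    have := hmax _ _ _ (hp.concat hs hadj)
    rw [SimpleGraph.Walk.length_concat] at this
    omega
  exact congrArg Subtype.val (hH.eq_penultimate_of_adj_end hp hadj hs)

/-- A forest without isolated vertices has a leaf `x` whose neighbour `y` has at most one
neighbour which is not a leaf. -/
theorem SimpleGraph.IsAcyclic.exists_leaf (hG : G.IsAcyclic) {W : Finset V} (hW : W.Nonempty)
    (hiso : ∀ v ∈ W, ∃ w ∈ W, G.Adj v w) :
    ∃ x ∈ W, ∃ y ∈ W, G.Adj x y ∧ (∀ w ∈ W, G.Adj x w → w = y) ∧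
      ∃ z, ∀ w ∈ W, G.Adj y w → w ≠ z → ∀ u ∈ W, G.Adj w u → u = y := by
  classical
  -- The vertices with at least two neighbours in `W`. A vertex `y` with at most one neighbour `z`
  -- inside `W'` is the one sought.
  let W' := W.filter fun v => ¬ ∃ y, ∀ w ∈ W, G.Adj v w → w = y
  have hleaf : ∀ v ∈ W, v ∉ W' → ∀ y ∈ W, G.Adj v y → ∀ w ∈ W, G.Adj v w → w = y := by
    intro v hv hv' y hy hvy w hw hvw
    simp only [W', Finset.mem_filter, hv, true_and, not_not] at hv'
    obtain ⟨y', h⟩ := hv'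
    rw [h w hw hvw, h y hy hvy]
  rcases W'.eq_empty_or_nonempty with h | h
  · obtain ⟨x, hx⟩ := hW
    obtain ⟨y, hy, hxy⟩ := hiso x hx
    refine ⟨x, hx, y, hy, hxy, hleaf x hx (by simp [h]) y hy hxy, x, ?_⟩
    exact fun w hw hyw _ => hleaf w hw (by simp [h]) y hy hyw.symm
  · obtain ⟨y, hy, z, hz⟩ := hG.exists_unique_neighbor h
    have hyW : y ∈ W := Finset.mem_of_mem_filter _ hy
    have hy2 : ¬ ∃ z, ∀ w ∈ W, G.Adj y w → w = z := (Finset.mem_filter.1 hy).2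
    push Not at hy2
    -- As `y` has two neighbours, one of them differs from `z`; it lies outside `W'` and is
    -- therefore a leaf.
    obtain ⟨x, hx, hyx, hxz⟩ := hy2 z
    refine ⟨x, hx, y, hyW, hyx.symm, hleaf x hx (fun h' => hxz (hz x h' hyx)) y hyW hyx.symm,
      z, ?_⟩
    exact fun w hw hyw hwz => hleaf w hw (fun h' => hwz (hz w h' hyw)) y hyW hyw.symm

end Matchings

/-! ### Homology of the families defined by matchings -/

section MatchingFamilies

variable {V : Type*} [LinearOrder V] (G : SimpleGraph V)

theorem ordConnected_of_mono {V : Type*} {W : Finset V} {P Q : Finset V → Prop}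
    (hP : ∀ A B, A ⊆ B → P B → P A) (hQ : ∀ A B, A ⊆ B → Q A → Q B) :
    {F | F ⊆ W ∧ P F ∧ Q F}.OrdConnected :=
  ⟨fun A hA C hC _ hB => ⟨hB.2.trans hC.1, hP _ C hB.2 hC.2.1, hQ A _ hB.1 hA.2.2⟩⟩

/-- Sets whose complement in `W` contains a `k`-matching. -/
def matchFamily (W : Finset V) (k : ℕ) : Set (Finset V) :=
  {F | F ⊆ W ∧ HasMatching G k (W \ F)}

/-- Sets whose complement in `W` contains no `k`-matching. -/
def nonMatchFamily (W : Finset V) (k : ℕ) : Set (Finset V) :=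
  {F | F ⊆ W ∧ ¬ HasMatching G k (W \ F)}

/-- Sets whose complement in `W` has matching number `k`. -/
def levelFamily (W : Finset V) (k : ℕ) : Set (Finset V) :=
  {F | F ⊆ W ∧ HasMatching G k (W \ F) ∧ ¬ HasMatching G (k + 1) (W \ F)}

/-- Sets whose complement in `W` contains a `k`-matching only with the help of `x`. -/
def criticalFamily (W : Finset V) (x : V) (k : ℕ) : Set (Finset V) :=
  {F | F ⊆ W.erase x ∧ HasMatching G k (W \ F) ∧ ¬ HasMatching G k (W.erase x \ F)}

variable {G}

theorem not_hasMatching_empty (k : ℕ) : ¬ HasMatching G (k + 1) ∅ := by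
  rintro ⟨a, _, ha, _⟩
  simp at ha

theorem HasMatching.anti_sdiff {k : ℕ} {W : Finset V} (A B : Finset V) (h : A ⊆ B)
    (hB : HasMatching G k (W \ B)) : HasMatching G k (W \ A) :=
  hB.mono (Finset.sdiff_subset_sdiff subset_rfl h)

theorem nonMatchFamily_ordConnected (W : Finset V) (k : ℕ) :
    (nonMatchFamily G W k).OrdConnected := by
  have := ordConnected_of_mono (W := W) (P := fun _ => True)
    (Q := fun F => ¬ HasMatching G k (W \ F)) (fun _ _ _ _ => trivial)
    (fun A B h hA hB => hA (hB.anti_sdiff _ _ h))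
  unfold nonMatchFamily
  simpa only [true_and] using this

theorem levelFamily_ordConnected (W : Finset V) (k : ℕ) : (levelFamily G W k).OrdConnected :=
  ordConnected_of_mono (fun _ _ h hB => hB.anti_sdiff _ _ h)
    (fun _ _ h hA hB => hA (hB.anti_sdiff _ _ h))

theorem criticalFamily_ordConnected (W : Finset V) (x : V) (k : ℕ) :
    (criticalFamily G W x k).OrdConnected :=
  ordConnected_of_mono (fun _ _ h hB => hB.anti_sdiff _ _ h)
    (fun _ _ h hA hB => hA (hB.anti_sdiff _ _ h))

variable [Fintype V] (K L : Type*) [Field K] [Field L]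

/-- The sets that remain in the family after `x` is erased form a quotient that is a cone with apex
`x`. What is left is `x` joined to the critical sets, and the join shifts degrees by one. -/
theorem familyH_nonMatchFamily {W : Finset V} {x : V} (hx : x ∈ W) (k : ℕ) (p : ℤ) :
    familyH K (nonMatchFamily G W k) (p + 1) = familyH K (criticalFamily G W x k) p := by
  rw [← familyH_insert K (x := x) (criticalFamily_ordConnected W x k) (by
    rintro F ⟨hF, -⟩ hxF
    exact Finset.notMem_erase x W (hF hxF))]
  refine IsSplit.familyH_of_right K (v := x)
    (ℬ := {F | F ⊆ W ∧ ¬ HasMatching G k (W \ F.erase x)})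
    ⟨nonMatchFamily_ordConnected W k, fun F => ?_, ?_⟩ ?_ _
  · simp only [nonMatchFamily, criticalFamily, Set.mem_ofPred_eq]
    constructor
    · rintro ⟨hF, hm⟩
      by_cases h : HasMatching G k (W \ F.erase x)
      · have hxF : x ∈ F := by
          by_contra hxF
          rw [Finset.erase_eq_of_notMem hxF] at h
          exact hm h
        refine .inl ⟨hxF, Finset.erase_subset_erase x hF, h, ?_⟩
        rwa [show W.erase x \ F.erase x = W \ F by grind]
      · exact .inr ⟨hF, h⟩
    · rintro (⟨hxF, hF, h, hm⟩ | ⟨hF, h⟩)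
      · refine ⟨fun w hw => if h : w = x then h ▸ hx else
          Finset.mem_of_mem_erase (hF (Finset.mem_erase.2 ⟨h, hw⟩)), ?_⟩
        rwa [show W.erase x \ F.erase x = W \ F by grind] at hm
      · exact ⟨hF, fun h' => h (h'.anti_sdiff _ _ (Finset.erase_subset _ _))⟩
  · rintro A ⟨hxA, hA, h, -⟩ B ⟨hB, hB'⟩ hBA
    exact hB' (h.anti_sdiff _ _ (Finset.erase_subset_erase x hBA))
  · intro F hF
    simp only [Set.mem_ofPred_eq]
    rw [Finset.erase_insert_eq_erase]
    refine and_congr_left fun _ => ?_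
    grind

/-- The homology of `𝒞` has the same dimensions over `K` and over `L`. -/
def SameHomology (𝒞 : Set (Finset V)) : Prop :=
  ∀ p, familyH K 𝒞 p = familyH L 𝒞 p

variable {K L}

theorem SameHomology.of_shift {𝒜 ℬ : Set (Finset V)} (h : SameHomology K L 𝒜)
    (hK : ∀ p, familyH K ℬ (p + 1) = familyH K 𝒜 p)
    (hL : ∀ p, familyH L ℬ (p + 1) = familyH L 𝒜 p) : SameHomology K L ℬ := fun p => by
  have h1 := hK (p - 1)
  have h2 := hL (p - 1)
  rw [sub_add_cancel] at h1 h2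
  rw [h1, h2, h]

theorem SameHomology.of_shift' {𝒜 ℬ : Set (Finset V)} (h : SameHomology K L ℬ)
    (hK : ∀ p, familyH K ℬ (p + 1) = familyH K 𝒜 p)
    (hL : ∀ p, familyH L ℬ (p + 1) = familyH L 𝒜 p) : SameHomology K L 𝒜 := fun p => by
  rw [← hK, ← hL, h]

theorem SameHomology.of_toggle {v : V} {𝒞 : Set (Finset V)} (hv : IsToggle v 𝒞)
    (h : 𝒞.OrdConnected) : SameHomology K L 𝒞 := fun p => by
  rw [familyH_of_toggle K hv h, familyH_of_toggle L hv h]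

theorem sameHomology_empty : SameHomology K L (∅ : Set (Finset V)) := fun p => by
  rw [familyH_empty, familyH_empty]

theorem SameHomology.insert {x : V} {𝒜 : Set (Finset V)} (h : SameHomology K L 𝒜)
    (h𝒜 : 𝒜.OrdConnected) (hx : ∀ F ∈ 𝒜, x ∉ F) :
    SameHomology K L {F | x ∈ F ∧ F.erase x ∈ 𝒜} :=
  h.of_shift (familyH_insert K h𝒜 hx) (familyH_insert L h𝒜 hx)

theorem familyH_singleton_empty (K : Type*) [Field K] (p : ℤ) :
    familyH K ({∅} : Set (Finset V)) p = if p = 0 then 1 else 0 := by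
  rw [familyH_eq K Set.ordConnected_singleton]
  split_ifs with hp
  · subst hp
    rw [← Module.length_eq_one K K, ← qlen_bot_top]
    have hC1 : ∀ f ∈ familyChains K ({∅} : Set (Finset V)) (0 + 1), f = 0 := by
      intro f hf
      funext F
      by_contra hne
      obtain ⟨h1, h2⟩ := hf F hne
      rw [Set.mem_singleton_iff.1 h1] at h2
      simp at h2
    refine qlen_congr (LinearMap.proj ∅) (fun _ _ => trivial) ?_ ?_
    · intro c _
      refine ⟨Pi.single ∅ c, ⟨fun F hF => ?_, ?_⟩, by simp⟩
      · have : F = ∅ := by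
          by_contra hne
          exact hF (by simp [hne])
        simp [this]
      · funext F
        by_cases h : F = ∅
        · subst h
          change familyProj K _ _ ∅ = 0
          rw [familyProj_of_mem (Set.mem_singleton _), koszulD_apply, Finset.sum_eq_zero]
          intro v _
          simp
        · exact familyProj_of_notMem (by simpa using h) _
    · intro f hf
      constructor
      · intro h
        have : f = 0 := by
          funext F
          by_contra hne
          rw [Set.mem_singleton_iff.1 (hf.1 F hne).1] at hne
          exact hne h
        rw [this]
        exact zero_mem _
      · rintro ⟨g, hg, rfl⟩
        rw [hC1 g hg, map_zero]
        exact zero_mem _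
  · refine SubspaceComplex.hdim_eq_zero fun f hf _ => ⟨0, zero_mem _, ?_⟩
    rw [map_zero]
    funext F
    by_contra hne
    obtain ⟨h1, h2⟩ := hf F (Ne.symm hne)
    rw [Set.mem_singleton_iff.1 h1] at h2
    exact hp (by simpa using h2.symm)

theorem sameHomology_singleton_empty : SameHomology K L ({∅} : Set (Finset V)) := fun p => by
  rw [familyH_singleton_empty, familyH_singleton_empty]

/-- Deleting a vertex costs at most one edge, so the sets `F` such that `W \ F` without `v` has no
`k`-matching form a family lying between the two `nonMatchFamily`s. It is a cone with apex `v`,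
hence the projection between the outer two is zero on homology. -/
theorem familyH_levelFamily (K : Type*) [Field K] {W : Finset V} {v : V} (hv : v ∈ W) (k : ℕ)
    (p : ℤ) : familyH K (levelFamily G W k) p =
      familyH K (nonMatchFamily G W (k + 1)) p + familyH K (nonMatchFamily G W k) (p + 1) := by
  have hM : ({F | F ⊆ W ∧ ¬ HasMatching G k (W.erase v \ F)} : Set (Finset V)).OrdConnected := by
    have := ordConnected_of_mono (W := W) (P := fun _ => True)
      (Q := fun F => ¬ HasMatching G k (W.erase v \ F)) (fun _ _ _ _ => trivial)
      (fun A B h hA hB => hA (hB.anti_sdiff _ _ h))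
    simpa only [true_and] using this
  refine IsSplit.familyH_of_factor K (v := v) (ℳ := {F | F ⊆ W ∧ ¬ HasMatching G k (W.erase v \ F)})
    (𝒜₁ := {F | F ⊆ W ∧ ¬ HasMatching G (k + 1) (W \ F) ∧ HasMatching G k (W.erase v \ F)})
    (𝒜₂ := {F | F ⊆ W ∧ ¬ HasMatching G k (W.erase v \ F) ∧ HasMatching G k (W \ F)})
    ⟨nonMatchFamily_ordConnected W _, fun F => ?_, ?_⟩
    ⟨nonMatchFamily_ordConnected W _, fun F => ?_, ?_⟩
    ⟨hM, fun F => ?_, ?_⟩ ?_ p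
  · simp only [levelFamily, nonMatchFamily, Set.mem_ofPred_eq]
    have := @HasMatching.pred V _ G k (W \ F)
    tauto
  · rintro A ⟨-, hA, -⟩ B ⟨-, hB⟩ h
    exact hB (hA.anti_sdiff _ _ h)
  · simp only [nonMatchFamily, Set.mem_ofPred_eq]
    have : HasMatching G (k + 1) (W \ F) → HasMatching G k (W.erase v \ F) := fun h => by
      rw [show W.erase v \ F = (W \ F).erase v by grind]
      exact h.erase v
    tauto
  · rintro A ⟨-, -, hA⟩ B ⟨-, hB⟩ h
    exact hB (hA.anti_sdiff _ _ h)
  · simp only [nonMatchFamily, Set.mem_ofPred_eq]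
    have : HasMatching G k (W.erase v \ F) → HasMatching G k (W \ F) := fun h =>
      h.mono (by grind)
    tauto
  · rintro A ⟨-, -, hA⟩ B ⟨-, hB⟩ h
    exact hB (hA.anti_sdiff _ _ h)
  · intro F hF
    simp only [Set.mem_ofPred_eq]
    rw [show W.erase v \ insert v F = W.erase v \ F by grind]
    refine and_congr_left fun _ => ?_
    grind

theorem SameHomology.levelFamily {W : Finset V} {k : ℕ}
    (h : SameHomology K L (nonMatchFamily G W k))
    (h' : SameHomology K L (nonMatchFamily G W (k + 1))) :
    SameHomology K L (levelFamily G W k) := by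
  -- With `W` empty there is no apex `v`, and the family is computed directly.
  rcases W.eq_empty_or_nonempty with rfl | ⟨v, hv⟩
  · have : _root_.levelFamily G (∅ : Finset V) k =
        if k = 0 then {∅} else ∅ := by
      ext F
      cases k with
      | zero =>
        simp [_root_.levelFamily, HasMatching]
      | succ k =>
        simp [_root_.levelFamily, not_hasMatching_empty]
    rw [this]
    split_ifs
    · exact sameHomology_singleton_empty
    · exact sameHomology_empty
  · intro p
    rw [familyH_levelFamily K hv, familyH_levelFamily L hv, h, h']

/-- Strong induction on `W`, for all `k` at once; the edges removed with the leaf lower `k`, and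
level families need two consecutive values. -/
theorem sameHomology_nonMatchFamily (hG : G.IsAcyclic) (W : Finset V) (k : ℕ) :
    SameHomology K L (nonMatchFamily G W k) := by
  induction W using Finset.strongInduction generalizing k with
  | H W ih =>
  cases k with
  | zero =>
    have : nonMatchFamily G W 0 = ∅ := by
      ext F; simp [nonMatchFamily, HasMatching]
    rw [this]
    exact sameHomology_empty
  | succ k =>
  rcases W.eq_empty_or_nonempty with rfl | hW
  · have : nonMatchFamily G (∅ : Finset V) (k + 1) = {∅} := by
      ext F; simp [nonMatchFamily, not_hasMatching_empty]
    rw [this]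
    exact sameHomology_singleton_empty
  by_cases hiso : ∀ v ∈ W, ∃ w ∈ W, G.Adj v w
  swap
  · push Not at hiso
    obtain ⟨v, hv, hiso⟩ := hiso
    refine SameHomology.of_toggle (v := v) (fun F hF => ?_) (nonMatchFamily_ordConnected W _)
    simp only [nonMatchFamily, Set.mem_ofPred_eq]
    rw [show W \ insert v F = (W \ F).erase v by grind,
      hasMatching_erase_iff fun w hw => hiso w (by grind)]
    refine and_congr_left fun _ => ?_
    grind
  obtain ⟨x, hx, y, hy, hxy, hxleaf, z, hz⟩ := hG.exists_leaf hW hiso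
  have hne : x ≠ y := hxy.ne
  -- If `y` carries a second leaf `x'`, the members without `x` form a cone with apex `x'`, and
  -- those containing `x` are `x` joined to the family on `W.erase x`.
  by_cases htwin : ∃ x' ∈ W, x' ≠ x ∧ ∀ u ∈ W, G.Adj x' u → u = y
  · obtain ⟨x', hx', hx'x, hx'leaf⟩ := htwin
    have h1 : SameHomology K L {F | x ∈ F ∧ F.erase x ∈ nonMatchFamily G (W.erase x) (k + 1)} :=
      (ih _ (Finset.erase_ssubset hx) _).insert (nonMatchFamily_ordConnected _ _) (by
        rintro F ⟨hF, -⟩ hxF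
        exact Finset.notMem_erase x W (hF hxF))
    have S : IsSplit {F | F ∈ nonMatchFamily G W (k + 1) ∧ x ∉ F} (nonMatchFamily G W (k + 1))
        {F | x ∈ F ∧ F.erase x ∈ nonMatchFamily G (W.erase x) (k + 1)} := by
      refine ⟨nonMatchFamily_ordConnected W _, fun F => ?_, fun A hA B hB h => hA.2 (h hB.1)⟩
      simp only [nonMatchFamily, Set.mem_ofPred_eq]
      by_cases hxF : x ∈ F
      · rw [show W.erase x \ F.erase x = W \ F by grind]
        have : F.erase x ⊆ W.erase x ↔ F ⊆ W := by grind
        simp [hxF, this]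
      · simp [hxF]
    have htog : IsToggle x' {F | F ∈ nonMatchFamily G W (k + 1) ∧ x ∉ F} := by
      intro F hF
      simp only [nonMatchFamily, Set.mem_ofPred_eq]
      by_cases hxF : x ∈ F
      · simp [hxF]
      · rw [show W \ insert x' F = (W \ F).erase x' by grind,
          hasMatching_twin_iff (x := x) (y := y) (by grind) hx'x.symm hxy
            (fun w hw => hxleaf w (by grind)) (fun w hw => hx'leaf w (by grind))]
        grind
    intro p
    rw [S.familyH_of_left K htog, S.familyH_of_left L htog, h1]
  -- A critical set cannot contain `y`: otherwise `x` would be isolated in `W \ F` and useless for a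
  -- matching. So the leaf edge is available, and removing it leaves a `k`-matching.
  have hcrit : ∀ F, F ∈ criticalFamily G W x (k + 1) →
      F ⊆ W \ {x, y} ∧ HasMatching G k ((W \ {x, y}) \ F) := by
    rintro F ⟨hF, h1, h2⟩
    have hyF : y ∉ F := by
      intro hyF
      refine h2 ?_
      rw [show W.erase x \ F = (W \ F).erase x by grind, hasMatching_erase_iff]
      · exact h1
      · intro w hw hxw
        have := hxleaf w (by grind) hxw
        grind
    refine ⟨by grind, ?_⟩
    rw [hasMatching_leaf_iff (x := x) (y := y) (by grind) (by grind) hxy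
      (fun w hw => hxleaf w (by grind))] at h1
    exact h1.mono (by grind)
  have hcrit' : ∀ F, F ⊆ W \ {x, y} → HasMatching G k ((W \ {x, y}) \ F) →
      HasMatching G (k + 1) (W \ F) := by
    intro F hF h
    exact ⟨x, y, by grind, by grind, hxy, h.mono (by grind)⟩
  have hss : W \ {x, y} ⊂ W := ⟨Finset.sdiff_subset, fun h => by have := h hx; grind⟩
  suffices h : SameHomology K L (criticalFamily G W x (k + 1)) from
    h.of_shift (familyH_nonMatchFamily K hx _) (familyH_nonMatchFamily L hx _)
  by_cases hzW : z ∈ W ∧ G.Adj y z ∧ z ≠ x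
  · obtain ⟨hzW, hyz, hzx⟩ := hzW
    have hzy : z ≠ y := hyz.ne'
    have hy2 : ∀ w ∈ W, G.Adj y w → w = x ∨ w = z := by
      intro w hw hyw
      by_contra h
      push Not at h
      exact htwin ⟨w, hw, h.1, hz w hw hyw h.2⟩
    have hss' : (W \ {x, y}).erase z ⊂ W :=
      (Finset.erase_subset _ _).trans_ssubset hss
    have hT : SameHomology K L (criticalFamily G (W \ {x, y}) z k) :=
      (ih _ hss k).of_shift' (familyH_nonMatchFamily K (by grind) _)
        (familyH_nonMatchFamily L (by grind) _)
    have hZ : SameHomology K L {F | z ∈ F ∧ F.erase z ∈ levelFamily G ((W \ {x, y}).erase z) k} :=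
      ((ih _ hss' k).levelFamily (ih _ hss' (k + 1))).insert (levelFamily_ordConnected _ _) (by
        rintro F ⟨hF, -⟩ hzF
        exact Finset.notMem_erase z _ (hF hzF))
    -- Without a second leaf, `y` has only the neighbours `x` and `z`. Once `x` is gone, `y` is
    -- isolated if `z ∈ F` (`key1`) and a leaf at `z` if `z ∉ F` (`key2`); these two cases give the
    -- two pieces.
    have S : IsSplit (criticalFamily G (W \ {x, y}) z k) (criticalFamily G W x (k + 1))
        {F | z ∈ F ∧ F.erase z ∈ levelFamily G ((W \ {x, y}).erase z) k} := by
      refine ⟨criticalFamily_ordConnected W _ _, fun F => ?_, ?_⟩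
      · have key1 : F ⊆ W \ {x, y} → z ∈ F → (HasMatching G (k + 1) (W.erase x \ F) ↔
            HasMatching G (k + 1) ((W \ {x, y}).erase z \ F.erase z)) := by
          intro hF hzF
          rw [← hasMatching_erase_iff (v := y),
            show (W.erase x \ F).erase y = (W \ {x, y}).erase z \ F.erase z by grind]
          intro w hw hyw
          have := hy2 w (by grind) hyw
          grind
        have key2 : F ⊆ W \ {x, y} → z ∉ F → (HasMatching G (k + 1) (W.erase x \ F) ↔
            HasMatching G k ((W \ {x, y}).erase z \ F)) := by
          intro hF hzF
          rw [hasMatching_leaf_iff (x := y) (y := z) (by grind) (by grind) hyz,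
            show (W.erase x \ F) \ {y, z} = (W \ {x, y}).erase z \ F by grind]
          intro w hw hyw
          have := hy2 w (by grind) hyw
          grind
        constructor
        · intro h
          obtain ⟨hF, hm⟩ := hcrit F h
          by_cases hzF : z ∈ F
          · refine .inr ⟨hzF, by grind, ?_, fun h' => h.2.2 ((key1 hF hzF).2 h')⟩
            exact hm.mono (by grind)
          · exact .inl ⟨by grind, hm, fun h' => h.2.2 ((key2 hF hzF).2 h')⟩
        · rintro (⟨hF, h1, h2⟩ | ⟨hzF, hF, h1, h2⟩)
          · have hF' : F ⊆ W \ {x, y} := hF.trans (Finset.erase_subset _ _)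
            have hzF : z ∉ F := fun h => Finset.notMem_erase z _ (hF h)
            exact ⟨by grind, hcrit' F hF' h1, fun h' => h2 ((key2 hF' hzF).1 h')⟩
          · have hF' : F ⊆ W \ {x, y} := by
              rw [← Finset.insert_erase hzF]
              refine Finset.insert_subset (by grind) (hF.trans (Finset.erase_subset _ _))
            exact ⟨by grind, hcrit' F hF' (h1.mono (by grind)), fun h' => h2 ((key1 hF' hzF).1 h')⟩
      · rintro A ⟨hA, -, -⟩ B ⟨hzB, -⟩ h
        exact Finset.notMem_erase z _ (hA (h hzB))
    -- Only inserting `z` could lead from one piece to the other, but the first piece forbids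
    -- exactly the `k`-matching that the second requires.
    have hdis : ∀ F ∈ criticalFamily G (W \ {x, y}) z k, ∀ v,
        insert v F ∉ {F | z ∈ F ∧ F.erase z ∈ levelFamily G ((W \ {x, y}).erase z) k} := by
      rintro F ⟨hF, -, h⟩ v ⟨hz', -, h', -⟩
      have hzF : z ∉ F := fun h => Finset.notMem_erase z _ (hF h)
      have hvz : z = v := by grind
      subst hvz
      rw [Finset.erase_insert hzF] at h'
      exact h h'
    intro p
    rw [S.familyH_of_disconnected K hdis, S.familyH_of_disconnected L hdis, hT, hZ]
  -- Here the edge `xy` is a whole component, so `y` is isolated once `x` is removed.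
  · have hy2 : ∀ w ∈ W, G.Adj y w → w = x := by
      intro w hw hyw
      by_contra h
      by_cases hwz : w = z
      · subst hwz
        exact hzW ⟨hw, hyw, h⟩
      · exact htwin ⟨w, hw, h, hz w hw hyw hwz⟩
    have : criticalFamily G W x (k + 1) = levelFamily G (W \ {x, y}) k := by
      ext F
      have key : F ⊆ W \ {x, y} → (HasMatching G (k + 1) (W.erase x \ F) ↔
          HasMatching G (k + 1) ((W \ {x, y}) \ F)) := by
        intro hF
        rw [← hasMatching_erase_iff (v := y),
          show (W.erase x \ F).erase y = (W \ {x, y}) \ F by grind]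
        intro w hw hyw
        have := hy2 w (by grind) hyw
        grind
      constructor
      · intro h
        obtain ⟨hF, hm⟩ := hcrit F h
        exact ⟨hF, hm, fun h' => h.2.2 ((key hF).2 h')⟩
      · rintro ⟨hF, h1, h2⟩
        exact ⟨by grind, hcrit' F hF h1, fun h' => h2 ((key hF).1 h')⟩
    rw [this]
    exact (ih _ hss k).levelFamily (ih _ hss (k + 1))

/-- This family and `nonMatchFamily` are complementary in the full simplex on `W`, which is acyclic
as soon as `W` has a vertex. -/
theorem sameHomology_matchFamily (hG : G.IsAcyclic) (W : Finset V) (k : ℕ) :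
    SameHomology K L (matchFamily G W k) := by
  rcases W.eq_empty_or_nonempty with rfl | ⟨v, hv⟩
  · have : matchFamily G (∅ : Finset V) k = if k = 0 then {∅} else ∅ := by
      ext F
      cases k with
      | zero => simp [matchFamily, HasMatching]
      | succ k => simp [matchFamily, not_hasMatching_empty]
    rw [this]
    split_ifs
    · exact sameHomology_singleton_empty
    · exact sameHomology_empty
  · have S : IsSplit (matchFamily G W k) {F | F ⊆ W} (nonMatchFamily G W k) := by
      refine ⟨⟨fun A hA B hB F hF => hF.2.trans hB⟩, fun F => ?_, ?_⟩
      · simp only [matchFamily, nonMatchFamily, Set.mem_ofPred_eq]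
        tauto
      · rintro A ⟨-, hA⟩ B ⟨-, hB⟩ h
        exact hB (hA.anti_sdiff _ _ h)
    have hv' : IsToggle v {F | F ⊆ W} := by
      intro F hF
      simp only [Set.mem_ofPred_eq]
      grind
    exact (sameHomology_nonMatchFamily hG W k).of_shift' (S.familyH_of_middle K hv')
      (S.familyH_of_middle L hv')

end MatchingFamilies


/-! ### Graded free modules over the polynomial ring -/

section GradedFree

variable {V K : Type*} [Field K]

open Classical in
/-- The projection onto the span of the monomials with exponents satisfying `Q`. -/
def filterCoeff (Q : (V →₀ ℕ) → Prop) : MvPolynomial V K →ₗ[K] MvPolynomial V K :=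
  (basisMonomials V K).constr K fun m => if Q m then monomial m 1 else 0

theorem coeff_filterCoeff (Q : (V →₀ ℕ) → Prop) [DecidablePred Q] (m : V →₀ ℕ)
    (f : MvPolynomial V K) : coeff m (filterCoeff Q f) = if Q m then coeff m f else 0 := by
  classical
  induction f using MvPolynomial.induction_on' with
  | monomial u a =>
    have : (monomial u a : MvPolynomial V K) = a • basisMonomials V K u := by
      rw [coe_basisMonomials, smul_monomial, smul_eq_mul, mul_one]
    rw [filterCoeff, this, map_smul, Module.Basis.constr_basis, coe_basisMonomials, coeff_smul,
      coeff_smul, coeff_monomial]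
    by_cases h : u = m
    · subst h
      rw [if_pos rfl]
      split_ifs <;> simp
    · simp only [h, if_false, smul_zero, ite_self]
      split_ifs <;> simp [h]
  | add p q hp hq =>
    rw [map_add, coeff_add, hp, hq, coeff_add]
    split_ifs <;> simp

variable {r r' : ℕ}

/-- The homogeneous vectors of degree `n` in the graded free module `⊕_b S(-deg b)`. -/
def gradedPiece (deg : Fin r → ℕ) (n : ℤ) : Submodule K (Fin r → MvPolynomial V K) where
  carrier := {f | ∀ b m, coeff m (f b) ≠ 0 → (m.degree : ℤ) + deg b = n}
  zero_mem' := fun b m h => absurd (by simp) h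
  add_mem' := fun {f g} hf hg b m h => by
    by_cases h' : coeff m (f b) = 0
    · exact hg b m fun h'' => h (by simp [h', h''])
    · exact hf b m h'
  smul_mem' := fun c f hf b m h => hf b m fun h' => h (by simp [h'])

/-- The projection onto the homogeneous component of degree `n`. -/
def gradedProj (deg : Fin r → ℕ) (n : ℤ) :
    (Fin r → MvPolynomial V K) →ₗ[K] (Fin r → MvPolynomial V K) :=
  LinearMap.pi fun b => filterCoeff (fun m => (m.degree : ℤ) + deg b = n) ∘ₗ LinearMap.proj b

theorem coeff_gradedProj (deg : Fin r → ℕ) (n : ℤ) (f : Fin r → MvPolynomial V K) (b : Fin r)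
    (m : V →₀ ℕ) : coeff m (gradedProj deg n f b) =
      if (m.degree : ℤ) + deg b = n then coeff m (f b) else 0 := by
  exact coeff_filterCoeff _ m (f b)

theorem gradedProj_mem (deg : Fin r → ℕ) (n : ℤ) (f : Fin r → MvPolynomial V K) :
    gradedProj deg n f ∈ gradedPiece deg n := by
  intro b m h
  rw [coeff_gradedProj] at h
  by_contra h'
  exact h (if_neg h')

theorem gradedProj_eq_self {deg : Fin r → ℕ} {n : ℤ} {f : Fin r → MvPolynomial V K}
    (hf : f ∈ gradedPiece deg n) : gradedProj deg n f = f := by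
  funext b
  ext m
  rw [coeff_gradedProj, ite_eq_left_iff]
  intro h
  by_contra h'
  exact h (hf b m (Ne.symm h'))

theorem gradedProj_eq_zero {deg : Fin r → ℕ} {n n' : ℤ} {f : Fin r → MvPolynomial V K}
    (hf : f ∈ gradedPiece deg n') (hn : n' ≠ n) : gradedProj deg n f = 0 := by
  funext b
  ext m
  rw [coeff_gradedProj, Pi.zero_apply, coeff_zero, ite_eq_right_iff]
  intro h
  by_contra h'
  exact hn ((hf b m h').symm.trans h)

/-- Homogeneity of degree `0` of a map of graded free modules. -/
def IsGradedMap (deg : Fin r → ℕ) (deg' : Fin r' → ℕ)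
    (φ : (Fin r → MvPolynomial V K) →ₗ[MvPolynomial V K] (Fin r' → MvPolynomial V K)) : Prop :=
  ∀ a, IsHomogeneousVector deg' (deg a) (φ (Pi.single a 1))

variable {deg : Fin r → ℕ} {deg' : Fin r' → ℕ}
  {φ : (Fin r → MvPolynomial V K) →ₗ[MvPolynomial V K] (Fin r' → MvPolynomial V K)}

theorem linearMap_apply_eq_sum
    (φ : (Fin r → MvPolynomial V K) →ₗ[MvPolynomial V K] (Fin r' → MvPolynomial V K))
    (f : Fin r → MvPolynomial V K) : φ f = ∑ a, f a • φ (Pi.single a 1) := by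
  conv_lhs => rw [← Finset.univ_sum_single f]
  rw [map_sum]
  refine Finset.sum_congr rfl fun a _ => ?_
  rw [← map_smul, ← Pi.single_smul, smul_eq_mul, mul_one]

theorem IsGradedMap.map_mem (hφ : IsGradedMap deg deg' φ) {n : ℤ} {f : Fin r → MvPolynomial V K}
    (hf : f ∈ gradedPiece deg n) : φ f ∈ gradedPiece deg' n := by
  classical
  rw [linearMap_apply_eq_sum]
  refine sum_mem fun a _ => ?_
  intro b m hm
  rw [Pi.smul_apply, smul_eq_mul, coeff_mul] at hm
  obtain ⟨⟨m₁, m₂⟩, hm12, hm⟩ := Finset.exists_ne_zero_of_sum_ne_zero hm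
  have h1 := hf a m₁ (left_ne_zero_of_mul hm)
  have h2 := hφ a b m₂ (mem_support_iff.2 (right_ne_zero_of_mul hm))
  rw [← Finset.HasAntidiagonal.mem_antidiagonal.1 hm12, map_add]
  push_cast
  omega

/-- By linearity it is enough to check a monomial times a basis vector, which is homogeneous. -/
theorem IsGradedMap.map_gradedProj (hφ : IsGradedMap deg deg' φ) (n : ℤ)
    (f : Fin r → MvPolynomial V K) : φ (gradedProj deg n f) = gradedProj deg' n (φ f) := by
  classical
  have : (φ.restrictScalars K) ∘ₗ gradedProj deg n = gradedProj deg' n ∘ₗ φ.restrictScalars K := by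
    refine LinearMap.pi_ext fun a x => ?_
    induction x using MvPolynomial.induction_on' with
    | add p q hp hq => rw [Pi.single_add, map_add, map_add, hp, hq]
    | monomial m c => ?_
    have hmem : (Pi.single a (monomial m c) : Fin r → MvPolynomial V K) ∈
        gradedPiece deg ((m.degree : ℤ) + deg a) := by
      intro b m' h
      by_cases hb : b = a
      · subst hb
        rw [Pi.single_eq_same, coeff_monomial] at h
        have : m = m' := by
          by_contra h'
          exact h (if_neg h')
        rw [this]
      · rw [Pi.single_eq_of_ne hb] at h
        exact absurd (coeff_zero _) h
    change φ (gradedProj deg n (Pi.single a (monomial m c))) =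
      gradedProj deg' n (φ (Pi.single a (monomial m c)))
    by_cases hn : (m.degree : ℤ) + deg a = n
    · rw [hn] at hmem
      rw [gradedProj_eq_self hmem, gradedProj_eq_self (hφ.map_mem hmem)]
    · rw [gradedProj_eq_zero hmem hn, gradedProj_eq_zero (hφ.map_mem hmem) hn, map_zero]
  exact LinearMap.congr_fun this f

/-- Multiplication by a variable. -/
def mulX (r : ℕ) (v : V) : (Fin r → MvPolynomial V K) →ₗ[K] (Fin r → MvPolynomial V K) where
  toFun f := (X v : MvPolynomial V K) • f
  map_add' _ _ := smul_add _ _ _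
  map_smul' _ _ := smul_comm _ _ _

/-- Division by a variable, forgetting the monomials which are not divisible. -/
def divX (r : ℕ) (v : V) : (Fin r → MvPolynomial V K) →ₗ[K] (Fin r → MvPolynomial V K) where
  toFun f b := divMonomial (f b) (Finsupp.single v 1)
  map_add' f g := by
    funext b
    exact add_divMonomial _ _ _
  map_smul' c f := by
    funext b
    ext m
    simp [coeff_divMonomial]

theorem coeff_divX (v : V) (f : Fin r → MvPolynomial V K) (b : Fin r) (m : V →₀ ℕ) :
    coeff m (divX r v f b) = coeff (Finsupp.single v 1 + m) (f b) :=
  coeff_divMonomial _ _ _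

theorem divX_mulX (v : V) (f : Fin r → MvPolynomial V K) : divX r v (mulX r v f) = f := by
  funext b
  exact X_mul_divMonomial _ _

theorem coeff_mulX [DecidableEq V] (v : V) (f : Fin r → MvPolynomial V K) (b : Fin r)
    (m : V →₀ ℕ) : coeff m (mulX r v f b) =
      if m v ≠ 0 then coeff (m - Finsupp.single v 1) (f b) else 0 := by
  change coeff m (X v * f b) = _
  rw [coeff_X_mul']
  simp only [Finsupp.mem_support_iff]

theorem coeff_mulX_divX (v : V) (f : Fin r → MvPolynomial V K) (b : Fin r)
    (m : V →₀ ℕ) : coeff m (mulX r v (divX r v f) b) = if m v ≠ 0 then coeff m (f b) else 0 := by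
  classical
  rw [coeff_mulX]
  split_ifs with h
  · rw [coeff_divX, add_tsub_cancel_of_le]
    simpa using Nat.one_le_iff_ne_zero.2 h
  · rfl

theorem mulX_divX_comm {v w : V} (h : w ≠ v) (f : Fin r → MvPolynomial V K) :
    mulX r w (divX r v f) = divX r v (mulX r w f) := by
  classical
  funext b
  ext m
  rw [coeff_mulX, coeff_divX (f := mulX r w f), coeff_mulX]
  have : (Finsupp.single v 1 + m : V →₀ ℕ) w = m w := by simp [h]
  rw [this]
  split_ifs with h'
  · rw [coeff_divX, add_tsub_assoc_of_le]
    simpa using Nat.one_le_iff_ne_zero.2 h'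
  · rfl

theorem mulX_mem {n : ℤ} (v : V) {f : Fin r → MvPolynomial V K} (hf : f ∈ gradedPiece deg n) :
    mulX r v f ∈ gradedPiece deg (n + 1) := by
  classical
  intro b m h
  rw [coeff_mulX] at h
  split_ifs at h with hm
  · have h1 := hf b _ h
    have h2 : m - Finsupp.single v 1 + Finsupp.single v 1 = m := by
      rw [tsub_add_cancel_of_le]
      simpa using Nat.one_le_iff_ne_zero.2 hm
    rw [← h2, map_add, Finsupp.degree_single]
    push_cast
    omega
  · exact absurd rfl h

theorem divX_mem {n : ℤ} (v : V) {f : Fin r → MvPolynomial V K}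
    (hf : f ∈ gradedPiece deg (n + 1)) : divX r v f ∈ gradedPiece deg n := by
  intro b m h
  rw [coeff_divX] at h
  have h1 := hf b _ h
  rw [map_add, Finsupp.degree_single] at h1
  push_cast at h1
  omega

theorem isHomogeneousVector_iff {n : ℕ} {f : Fin r → MvPolynomial V K} :
    IsHomogeneousVector deg n f ↔ f ∈ gradedPiece deg n := by
  refine forall_congr' fun b => forall_congr' fun m => ?_
  rw [mem_support_iff]
  refine imp_congr_right fun _ => ?_
  norm_cast

end GradedFree


/-! ### Koszul homology of graded submodules -/

section KoszulStrand

variable {V K : Type*} [Field K] [LinearOrder V] [Fintype V] {r r' : ℕ}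

/-- The strand of degree `j` of the Koszul complex of a submodule `N` of a graded free module. -/
def koszulStrand (deg : Fin r → ℕ)
    (N : Submodule (MvPolynomial V K) (Fin r → MvPolynomial V K)) (j : ℤ) :
    SubspaceComplex K (Finset V → Fin r → MvPolynomial V K) where
  -- The internal degree `j - p` is an integer, and graded pieces of negative degree vanish, so no
  -- truncation occurs when `p` exceeds `j`.
  C p :=
    { carrier := {f | ∀ F, f F ∈ N ∧ f F ∈ gradedPiece deg (j - p) ∧ (f F ≠ 0 → (F.card : ℤ) = p)}
      zero_mem' := fun F => ⟨zero_mem _, zero_mem _, fun h => absurd rfl h⟩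
      add_mem' := fun {f g} hf hg F =>
        ⟨add_mem (hf F).1 (hg F).1, add_mem (hf F).2.1 (hg F).2.1, fun h => by
          by_cases h' : f F = 0
          · exact (hg F).2.2 fun h'' => h (by simp [h', h''])
          · exact (hf F).2.2 h'⟩
      smul_mem' := fun c f hf F => by
        refine ⟨?_, Submodule.smul_mem _ c (hf F).2.1, fun h => (hf F).2.2 fun h' => h ?_⟩
        · rw [Pi.smul_apply, ← algebraMap_smul (MvPolynomial V K) c (f F)]
          exact Submodule.smul_mem _ _ (hf F).1
        · simp [h'] }
  D := koszulD (mulX r)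
  D_mem := by
    intro p f hf F
    rw [koszulD_apply]
    refine ⟨sum_mem fun v _ => zsmul_mem (N.smul_mem _ (hf _).1) _,
      sum_mem fun v _ => zsmul_mem ?_ _, fun h => ?_⟩
    · have := mulX_mem v (hf (insert v F)).2.1
      rwa [show j - (p + 1) + 1 = j - p by ring] at this
    · obtain ⟨v, hv, h⟩ := Finset.exists_ne_zero_of_sum_ne_zero h
      have := (hf (insert v F)).2.2 fun h' => h (by simp [h'])
      rw [Finset.card_insert_of_notMem (by simpa using hv)] at this
      push_cast at this
      omega
  D_D := fun p f _ => koszulD_koszulD _ (fun v w x => smul_comm (X v) (X w) x) f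

variable {deg : Fin r → ℕ} {deg' : Fin r' → ℕ}
  {N : Submodule (MvPolynomial V K) (Fin r → MvPolynomial V K)} {j p : ℤ}

theorem koszulH_mem_strand (v : V) {f : Finset V → Fin r → MvPolynomial V K}
    (hf : f ∈ (koszulStrand deg ⊤ j).C p) :
    koszulH v (divX r v) f ∈ (koszulStrand deg ⊤ j).C (p + 1) := by
  intro F
  rw [koszulH_apply]
  refine ⟨trivial, ?_, ?_⟩
  · split_ifs
    · refine zsmul_mem (divX_mem v ?_) _
      rw [show j - (p + 1) + 1 = j - p by ring]
      exact (hf _).2.1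
    · exact zero_mem _
  · split_ifs with hv
    · intro h
      have := (hf (F.erase v)).2.2 fun h' => h (by simp [h'])
      rw [← this, ← Finset.card_erase_add_one hv]
      push_cast
      rfl
    · exact fun h => absurd rfl h

/-- Cycles of the Koszul complex of a free module are boundaries up to constants. -/
theorem exists_koszul_boundary {f : Finset V → Fin r → MvPolynomial V K}
    (hf : f ∈ (koszulStrand deg ⊤ j).C p) (hD : koszulD (mulX r) f = 0) (T : Finset V) :
    ∃ g ∈ (koszulStrand deg ⊤ j).C (p + 1), ∀ F b m,
      coeff m ((f - koszulD (mulX r) g : Finset V → Fin r → MvPolynomial V K) F b) ≠ 0 →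
        ∀ v ∈ T, v ∉ F ∧ m v = 0 := by
  induction T using Finset.induction_on with
  | empty => exact ⟨0, zero_mem _, by simp⟩
  | insert v T _ ih =>
    obtain ⟨g, hg, h⟩ := ih
    have hx := sub_mem hf ((koszulStrand deg ⊤ j).D_mem p g hg)
    change f - koszulD (mulX r) g ∈ _ at hx
    have hDx : koszulD (mulX r) (f - koszulD (mulX r) g) = 0 := by
      rw [map_sub, hD, koszulD_koszulD _ (fun v w x => smul_comm (X v) (X w) x), sub_zero]
    set x := f - koszulD (mulX r) g with hxdef
    refine ⟨g + koszulH v (divX r v) x, add_mem hg (koszulH_mem_strand v hx), ?_⟩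
    have hsub : f - koszulD (mulX r) (g + koszulH v (divX r v) x) =
        x - koszulD (mulX r) (koszulH v (divX r v) x) := by
      rw [map_add, hxdef]; abel
    intro F b m hm
    rw [hsub] at hm
    -- By the homotopy formula, correcting the cycle `x` by this boundary kills all components with
    -- `v ∈ F` and all monomials divisible by the variable `v`.
    have key := koszulD_koszulH_add (mulX (K := K) r) v (divX r v)
      (fun w hw y => mulX_divX_comm hw y) x F
    rw [hDx, map_zero, Pi.zero_apply, add_zero] at key
    rw [Pi.sub_apply, key] at hm
    split_ifs at hm with hv
    · rw [divX_mulX, sub_self] at hm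
      exact absurd (coeff_zero _) hm
    · rw [Pi.sub_apply, coeff_sub, coeff_mulX_divX] at hm
      have hmv : m v = 0 := by
        by_contra h'
        rw [if_pos h', sub_self] at hm
        exact hm rfl
      rw [if_neg (not_not.2 hmv), sub_zero] at hm
      intro w hw
      rcases Finset.mem_insert.1 hw with rfl | hw
      · exact ⟨hv, hmv⟩
      · exact h F b m hm w hw

theorem exists_koszul_boundary_univ {f : Finset V → Fin r → MvPolynomial V K}
    (hf : f ∈ (koszulStrand deg ⊤ j).C p) (hD : koszulD (mulX r) f = 0) :
    ∃ g ∈ (koszulStrand deg ⊤ j).C (p + 1), ∀ F b m,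
      coeff m ((f - koszulD (mulX r) g : Finset V → Fin r → MvPolynomial V K) F b) ≠ 0 →
        F = ∅ ∧ m = 0 := by
  obtain ⟨g, hg, h⟩ := exists_koszul_boundary hf hD Finset.univ
  refine ⟨g, hg, fun F b m hm => ⟨?_, ?_⟩⟩
  · exact Finset.eq_empty_of_forall_notMem fun v => (h F b m hm v (Finset.mem_univ v)).1
  · ext v
    exact (h F b m hm v (Finset.mem_univ v)).2

theorem hdim_koszulStrand_top_of_ne (hp : p ≠ 0) :
    (koszulStrand (K := K) (V := V) deg ⊤ j).hdim p = 0 := by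
  refine SubspaceComplex.hdim_eq_zero fun f hf hD => ?_
  obtain ⟨g, hg, h⟩ := exists_koszul_boundary_univ hf hD
  refine ⟨g, hg, (sub_eq_zero.1 ?_).symm⟩
  have hx := sub_mem hf ((koszulStrand deg ⊤ j).D_mem p g hg)
  funext F b
  ext m
  by_contra hm
  obtain ⟨rfl, rfl⟩ := h F b m hm
  have := (hx ∅).2.2 fun h0 => hm (by
    change coeff 0 ((f - (koszulStrand deg ⊤ j).D g) ∅ b) = _
    rw [h0]; rfl)
  exact hp (by simpa using this.symm)

theorem constantCoeff_koszulD (g : Finset V → Fin r → MvPolynomial V K) (F : Finset V)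
    (b : Fin r) : coeff 0 (koszulD (mulX r) g F b) = 0 := by
  rw [koszulD_apply, Finset.sum_apply, coeff_sum]
  refine Finset.sum_eq_zero fun v _ => ?_
  rw [Pi.smul_apply]
  refine (map_zsmul (lcoeff K (0 : V →₀ ℕ)) _ _).trans ?_
  rw [lcoeff_apply, coeff_mulX, if_neg (by simp), smul_zero]

theorem koszulD_eq_zero_of_mem_zero {f : Finset V → Fin r → MvPolynomial V K}
    (hf : f ∈ (koszulStrand deg N j).C 0) : koszulD (mulX r) f = 0 := by
  funext F
  rw [koszulD_apply]
  refine Finset.sum_eq_zero fun v _ => ?_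
  have : f (insert v F) = 0 := by
    by_contra h
    have := (hf _).2.2 h
    simp at this
  rw [this, map_zero, smul_zero]

/-- Constant terms are the only obstruction to being a boundary, and by homogeneity they occur only
in coordinates with `deg b = j`. -/
theorem mem_B_of_coeff_zero {f : Finset V → Fin r → MvPolynomial V K}
    (hf : f ∈ (koszulStrand deg ⊤ j).C 0) (h0 : ∀ b, (deg b : ℤ) = j → coeff 0 (f ∅ b) = 0) :
    f ∈ (koszulStrand deg ⊤ j).B 0 := by
  obtain ⟨g, hg, h⟩ := exists_koszul_boundary_univ hf (koszulD_eq_zero_of_mem_zero hf)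
  refine ⟨g, hg, (sub_eq_zero.1 ?_).symm⟩
  funext F b
  ext m
  by_contra hm
  obtain ⟨rfl, rfl⟩ := h F b m hm
  apply hm
  change coeff 0 (f ∅ b - koszulD (mulX r) g ∅ b) = _
  rw [coeff_sub, constantCoeff_koszulD, sub_zero, Pi.zero_apply, Pi.zero_apply, coeff_zero]
  by_contra hne
  have := (hf ∅).2.1 b 0 hne
  refine hne (h0 b ?_)
  simpa using this

theorem hdim_koszulStrand_top_zero :
    (koszulStrand (K := K) (V := V) deg ⊤ j).hdim 0 =
      (Finset.univ.filter fun a => (deg a : ℤ) = j).card := by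
  let f : (Finset V → Fin r → MvPolynomial V K) →ₗ[K] ({a // (deg a : ℤ) = j} → K) :=
    LinearMap.pi fun a => lcoeff K 0 ∘ₗ LinearMap.proj a.1 ∘ₗ LinearMap.proj ∅
  have hlen : Module.length K ({a // (deg a : ℤ) = j} → K) =
      (Finset.univ.filter fun a => (deg a : ℤ) = j).card := by
    rw [Module.length_eq_finrank, Module.finrank_fintype_fun_eq_card, Fintype.card_subtype]
  rw [← hlen, ← qlen_bot_top]
  refine qlen_congr f (fun _ _ => trivial) ?_ ?_
  · intro g _
    let u : Fin r → MvPolynomial V K := fun a => if h : (deg a : ℤ) = j then C (g ⟨a, h⟩) else 0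
    have hmem : (Pi.single ∅ u : Finset V → Fin r → MvPolynomial V K) ∈
        (koszulStrand deg ⊤ j).C 0 := by
      intro F
      refine ⟨trivial, ?_, ?_⟩
      · by_cases hF : F = ∅
        · subst hF
          rw [Pi.single_eq_same]
          intro b m hm
          dsimp only [u] at hm
          split_ifs at hm with hb
          · rw [coeff_C] at hm
            have : m = 0 := by
              by_contra h'
              exact hm (if_neg (Ne.symm h'))
            simp [this, hb]
          · exact absurd (coeff_zero _) hm
        · rw [Pi.single_eq_of_ne hF]
          exact zero_mem _
      · intro h
        have : F = ∅ := by
          by_contra hF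
          exact h (Pi.single_eq_of_ne hF _)
        simp [this]
    refine ⟨_, ⟨hmem, koszulD_eq_zero_of_mem_zero hmem⟩, ?_⟩
    funext a
    change coeff 0 ((Pi.single ∅ u : Finset V → Fin r → MvPolynomial V K) ∅ a.1) = g a
    rw [Pi.single_eq_same]
    dsimp only [u]
    rw [dif_pos a.2, coeff_C, if_pos rfl]
  · intro x hx
    constructor
    · intro h
      exact mem_B_of_coeff_zero hx.1 fun b hb => congrFun h ⟨b, hb⟩
    · rintro ⟨g, -, rfl⟩
      funext a
      exact constantCoeff_koszulD g ∅ a.1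

variable {φ : (Fin r → MvPolynomial V K) →ₗ[MvPolynomial V K] (Fin r' → MvPolynomial V K)}

/-- The Koszul complex is formed coordinatewise, so it preserves the exactness of kernel, source and
image. -/
theorem isShortExact_koszulStrand (hφ : IsGradedMap deg deg' φ) (j : ℤ) :
    SubspaceComplex.IsShortExact (koszulStrand deg (LinearMap.ker φ) j) (koszulStrand deg ⊤ j)
      (koszulStrand deg' (LinearMap.range φ) j) LinearMap.id
      ((φ.restrictScalars K).compLeft (Finset V)) where
  φ_mem := fun p f hf F => ⟨trivial, (hf F).2⟩
  ψ_mem := fun p f hf F => ⟨⟨f F, rfl⟩, hφ.map_mem (hf F).2.1, fun h => (hf F).2.2 fun h' => h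
    ((congrArg φ h').trans (map_zero φ))⟩
  φ_D := fun p f hf => rfl
  ψ_D := by
    intro p f hf
    funext F
    change φ (koszulD (mulX r) f F) = koszulD (mulX r') (fun F => φ (f F)) F
    rw [koszulD_apply, koszulD_apply, map_sum]
    refine Finset.sum_congr rfl fun v _ => ?_
    rw [map_zsmul]
    exact congrArg _ (map_smul φ (X v) _)
  inj := fun p f _ h => h
  zero := fun p f hf => funext fun F => (hf F).1
  exact := fun p f hf h => ⟨f, fun F => ⟨congrFun h F, (hf F).2⟩, rfl⟩
  surj := by
    classical
    intro p f hf
    choose g hg using fun F => (hf F).1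
    -- Projecting a preimage to degree `j - p` makes it homogeneous, and the case distinction keeps
    -- it supported on sets with `p` elements.
    refine ⟨fun F => if f F = 0 then 0 else gradedProj deg (j - p) (g F), fun F => ?_, ?_⟩
    · refine ⟨trivial, ?_, ?_⟩
      · dsimp only
        split_ifs
        · exact zero_mem _
        · exact gradedProj_mem _ _ _
      · intro h
        exact (hf F).2.2 fun h' => h (if_pos h')
    · funext F
      change φ (if f F = 0 then 0 else gradedProj deg (j - p) (g F)) = f F
      split_ifs with h
      · rw [map_zero, h]
      · rw [hφ.map_gradedProj, hg, gradedProj_eq_self (hf F).2.1]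

theorem hdim_koszulStrand_of_neg (hp : p < 0) : (koszulStrand deg N j).hdim p = 0 := by
  refine SubspaceComplex.hdim_eq_zero fun f hf _ => ⟨0, zero_mem _, ?_⟩
  rw [map_zero]
  funext F
  by_contra h
  have := (hf F).2.2 (Ne.symm h)
  omega

/-- The dimension shift for Koszul homology along a minimal graded presentation. -/
theorem hdim_koszulStrand_range (hφ : IsGradedMap deg deg' φ)
    (hmin : ∀ f, φ f = 0 → ∀ b, constantCoeff (f b) = 0) (j : ℤ) :
    (koszulStrand deg' (LinearMap.range φ) j).hdim 0 =
        (Finset.univ.filter fun a => (deg a : ℤ) = j).card ∧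
      ∀ p : ℕ, (koszulStrand deg' (LinearMap.range φ) j).hdim (p + 1) =
        (koszulStrand deg (LinearMap.ker φ) j).hdim p := by
  obtain ⟨r, s, t, h1, h2, h3, h4, -, -⟩ := (isShortExact_koszulStrand hφ j).exists_ranks
  have hrs : ∀ p ≠ 0, r p = 0 ∧ s p = 0 := fun p hp => by
    rw [← add_eq_zero, ← h2]
    exact hdim_koszulStrand_top_of_ne hp
  -- In degree `0` this is minimality: relations have no constant terms, so they vanish in the
  -- homology of the free module.
  have hr : ∀ p, r p = 0 := by
    intro p
    by_cases hp : p = 0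
    · subst hp
      refine h4 0 fun f hf hD => ?_
      exact mem_B_of_coeff_zero (fun F => ⟨trivial, (hf F).2⟩) fun b _ => hmin _ (hf ∅).1 b
    · exact (hrs p hp).1
  have ht : t 0 = 0 := by
    have := h1 (-1)
    rw [hdim_koszulStrand_of_neg (by norm_num), eq_comm, add_eq_zero] at this
    exact this.1
  constructor
  · rw [h3, ht, add_zero, ← hdim_koszulStrand_top_zero (K := K) (V := V), h2, hr, zero_add]
  · intro p
    rw [h3, h1, hr, (hrs (p + 1) (by omega)).2, zero_add, add_zero]

end KoszulStrand

/-! ### Betti numbers as Koszul homology -/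

section Betti

variable {V K : Type*} [Field K]

/-- An ideal as a submodule of the free module of rank one. -/
def idealSubmodule (I : Ideal (MvPolynomial V K)) :
    Submodule (MvPolynomial V K) (Fin 1 → MvPolynomial V K) :=
  Submodule.comap (LinearMap.proj 0) I

theorem constantCoeff_eq_zero_of_mem_span {f : MvPolynomial V K}
    (hf : f ∈ Ideal.span (Set.range (X : V → MvPolynomial V K))) : constantCoeff f = 0 := by
  have : Ideal.span (Set.range (X : V → MvPolynomial V K)) ≤
      RingHom.ker (constantCoeff : MvPolynomial V K →+* K) := by
    rw [Ideal.span_le]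
    rintro _ ⟨v, rfl⟩
    exact constantCoeff_X K v
  exact this hf

variable [LinearOrder V] [Fintype V] {I : Ideal (MvPolynomial V K)}

/-- Graded Betti numbers are the dimensions of the Koszul homology of the ideal. -/
theorem MinimalGradedFreeResolution.betti_eq (F : MinimalGradedFreeResolution I) (i j : ℕ) :
    (F.betti i j : ℕ∞) = (koszulStrand (fun _ => 0) (idealSubmodule I) (j : ℤ)).hdim i := by
  -- The target of the augmentation is viewed as a free module of rank one, so that the dimension
  -- shift applies to it as well.
  let aug' : (Fin (F.rank 0) → MvPolynomial V K) →ₗ[MvPolynomial V K]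
      (Fin 1 → MvPolynomial V K) := LinearMap.pi fun _ => F.aug
  have haug : IsGradedMap (F.deg 0) (fun _ => 0) aug' := by
    intro a b m hm
    have := F.aug_homogeneous a (mem_support_iff.1 hm)
    rw [add_zero, Finsupp.degree_eq_weight_one]
    exact this
  have hker : LinearMap.ker aug' = LinearMap.range (F.d 0) := by
    ext f
    rw [LinearMap.mem_range, ← Set.mem_range, ← F.exact_zero f, LinearMap.mem_ker]
    exact ⟨fun h => congrFun h 0, fun h => funext fun _ => h⟩
  have hker' : ∀ i, LinearMap.ker (F.d i) = LinearMap.range (F.d (i + 1)) := by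
    intro i
    exact (LinearMap.exact_iff.1 (F.exact_succ i))
  have hrange : LinearMap.range aug' = idealSubmodule I := by
    ext f
    rw [idealSubmodule, Submodule.mem_comap, LinearMap.proj_apply]
    conv_rhs => rw [← F.range_aug]
    constructor
    · rintro ⟨g, rfl⟩
      exact ⟨g, rfl⟩
    · rintro ⟨g, hg⟩
      exact ⟨g, funext fun b => by rw [Subsingleton.elim b 0, ← hg]; rfl⟩
  have hmin0 : ∀ f, aug' f = 0 → ∀ b, constantCoeff (f b) = 0 := by
    intro f hf b
    have hf' : f ∈ LinearMap.ker aug' := hf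
    rw [hker] at hf'
    obtain ⟨g, rfl⟩ := hf'
    exact constantCoeff_eq_zero_of_mem_span (F.minimal 0 g b)
  have hmin : ∀ i f, F.d i f = 0 → ∀ b, constantCoeff (f b) = 0 := by
    intro i f hf b
    have hf' : f ∈ LinearMap.ker (F.d i) := hf
    rw [hker'] at hf'
    obtain ⟨g, rfl⟩ := hf'
    exact constantCoeff_eq_zero_of_mem_span (F.minimal _ g b)
  have hgr : ∀ i, IsGradedMap (F.deg (i + 1)) (F.deg i) (F.d i) := fun i => F.d_homogeneous i
  -- The image of `F.d i` is the `(i + 1)`-st syzygy module of `I`; each syzygy step shifts Koszul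
  -- homology by one.
  have hshift : ∀ i p : ℕ, (koszulStrand (F.deg i) (LinearMap.range (F.d i)) (j : ℤ)).hdim p =
      (koszulStrand (fun _ => 0) (idealSubmodule I) (j : ℤ)).hdim ((p + i + 1 : ℕ) : ℤ) := by
    intro i
    induction i with
    | zero =>
      intro p
      rw [← hker, ← hrange, ← (hdim_koszulStrand_range haug hmin0 j).2]
      rfl
    | succ i ih =>
      intro p
      rw [← hker', ← (hdim_koszulStrand_range (hgr i) (hmin i) j).2]
      have := ih (p + 1)
      push_cast at this ⊢
      rw [this]
      ring_nf
  have hcard : ∀ i, (F.betti i j : ℕ∞) =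
      (Finset.univ.filter fun a => (F.deg i a : ℤ) = j).card := by
    intro i
    simp [MinimalGradedFreeResolution.betti]
  rw [hcard]
  cases i with
  | zero =>
    rw [← hrange]
    exact (hdim_koszulStrand_range haug hmin0 j).1.symm
  | succ i =>
    rw [← (hdim_koszulStrand_range (hgr i) (hmin i) j).1]
    have := hshift i 0
    simpa using this

end Betti


/-! ### Decomposition of the Koszul complex of a monomial ideal by multidegree -/

section Multidegrees

variable {V : Type*} [LinearOrder V] [Fintype V]

/-- The exponent of the squarefree monomial with support `F`. -/
def sqfreeExponent (F : Finset V) : V →₀ ℕ := Finsupp.equivFunOnFinite.symm fun v =>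
  if v ∈ F then 1 else 0

theorem sqfreeExponent_apply (F : Finset V) (v : V) :
    sqfreeExponent F v = if v ∈ F then 1 else 0 := rfl

theorem sqfreeExponent_insert {F : Finset V} {v : V} (hv : v ∉ F) :
    sqfreeExponent (insert v F) = sqfreeExponent F + Finsupp.single v 1 := by
  ext w
  rw [Finsupp.add_apply, sqfreeExponent_apply, sqfreeExponent_apply]
  by_cases hw : w = v
  · subst hw; simp [hv]
  · simp [hw]

theorem sqfreeExponent_le_iff {F : Finset V} {a : V →₀ ℕ} :
    sqfreeExponent F ≤ a ↔ F ⊆ a.support := by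
  rw [Finsupp.le_def]
  refine forall_congr' fun v => ?_
  rw [sqfreeExponent_apply, Finsupp.mem_support_iff]
  split_ifs with h <;> simp [h, Nat.one_le_iff_ne_zero]

theorem sqfreeExponent_mono {F F' : Finset V} (h : F ⊆ F') :
    sqfreeExponent F ≤ sqfreeExponent F' := by
  rw [sqfreeExponent_le_iff]
  intro v hv
  simp [sqfreeExponent_apply, h hv]

theorem degree_sqfreeExponent (F : Finset V) : (sqfreeExponent F).degree = F.card := by
  rw [Finsupp.degree_eq_sum]
  simp [sqfreeExponent_apply]

/-- The sets `F` such that `x^a / x_F` is a monomial with exponent in `P`. -/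
def upperKoszulFamily (P : (V →₀ ℕ) → Prop) (a : V →₀ ℕ) : Set (Finset V) :=
  {F | sqfreeExponent F ≤ a ∧ P (a - sqfreeExponent F)}

variable {P : (V →₀ ℕ) → Prop}

theorem upperKoszulFamily_lower (hP : ∀ m m', m ≤ m' → P m → P m') {a : V →₀ ℕ}
    {F F' : Finset V} (h : F ⊆ F') (hF : F' ∈ upperKoszulFamily P a) :
    F ∈ upperKoszulFamily P a :=
  ⟨(sqfreeExponent_mono h).trans hF.1, hP _ _ (tsub_le_tsub_left (sqfreeExponent_mono h) a) hF.2⟩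

theorem upperKoszulFamily_ordConnected (hP : ∀ m m', m ≤ m' → P m → P m') (a : V →₀ ℕ) :
    (upperKoszulFamily P a).OrdConnected :=
  ⟨fun _ _ _ hB _ hF => upperKoszulFamily_lower hP hF.2 hB⟩

variable {K : Type*} [Field K]

/-- The part in multidegrees `T` of the Koszul complex of the monomial ideal spanned by the
monomials with exponents in `P`. -/
def multidegreeStrand (K : Type*) [Field K] (hP : ∀ m m', m ≤ m' → P m → P m')
    (T : Finset (V →₀ ℕ)) : SubspaceComplex K (Finset V → Fin 1 → MvPolynomial V K) where
  C p :=
    { carrier := {f | ∀ F m, coeff m (f F 0) ≠ 0 →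
        P m ∧ m + sqfreeExponent F ∈ T ∧ (F.card : ℤ) = p}
      zero_mem' := fun F m h => absurd (coeff_zero _) h
      add_mem' := fun {f g} hf hg F m h => by
        by_cases h' : coeff m (f F 0) = 0
        · exact hg F m fun h'' => h (by simp [h', h''])
        · exact hf F m h'
      smul_mem' := fun c f hf F m h => hf F m fun h' => h (by simp [h']) }
  D := koszulD (mulX 1)
  D_mem := by
    intro p f hf F m h
    rw [koszulD_apply, Finset.sum_apply, coeff_sum] at h
    obtain ⟨v, hv, h⟩ := Finset.exists_ne_zero_of_sum_ne_zero h
    have h1 : coeff m (mulX 1 v (f (insert v F)) 0) ≠ 0 := fun h0 => h <|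
      (map_zsmul (lcoeff K m) _ _).trans (by rw [lcoeff_apply, h0, smul_zero])
    rw [coeff_mulX] at h1
    split_ifs at h1 with hm
    · obtain ⟨h2, h3, h4⟩ := hf _ _ h1
      have hv' : v ∉ F := by simpa using hv
      have hle : Finsupp.single v 1 ≤ m := by simpa using Nat.one_le_iff_ne_zero.2 hm
      refine ⟨hP _ _ tsub_le_self h2, ?_, ?_⟩
      · rwa [sqfreeExponent_insert hv', add_comm (sqfreeExponent F), ← add_assoc,
          tsub_add_cancel_of_le hle] at h3
      · rw [Finset.card_insert_of_notMem hv'] at h4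
        push_cast at h4
        omega
    · exact absurd rfl h1
  D_D := fun p f _ => koszulD_koszulD _ (fun v w x => smul_comm (X v) (X w) x) f

/-- The component of multidegree `a` of the Koszul complex, in terms of its monomial basis. -/
def multidegreeComponent (K : Type*) [Field K] (P : (V →₀ ℕ) → Prop) (a : V →₀ ℕ) :
    (Finset V → Fin 1 → MvPolynomial V K) →ₗ[K] (Finset V → K) :=
  familyProj K (upperKoszulFamily P a) ∘ₗ
    LinearMap.pi fun F => lcoeff K (a - sqfreeExponent F) ∘ₗ LinearMap.proj 0 ∘ₗ LinearMap.proj F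

theorem multidegreeComponent_of_mem {a : V →₀ ℕ} {F : Finset V} (hF : F ∈ upperKoszulFamily P a)
    (f : Finset V → Fin 1 → MvPolynomial V K) :
    multidegreeComponent K P a f F = coeff (a - sqfreeExponent F) (f F 0) :=
  familyProj_of_mem hF _

theorem multidegreeComponent_of_notMem {a : V →₀ ℕ} {F : Finset V}
    (hF : F ∉ upperKoszulFamily P a) (f : Finset V → Fin 1 → MvPolynomial V K) :
    multidegreeComponent K P a f F = 0 :=
  familyProj_of_notMem hF _

theorem coeff_koszulD (f : Finset V → Fin 1 → MvPolynomial V K) (F : Finset V) (m : V →₀ ℕ) :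
    coeff m (koszulD (mulX 1) f F 0) = ∑ v ∈ Fᶜ, koszulSign F v •
      if m v ≠ 0 then coeff (m - Finsupp.single v 1) (f (insert v F) 0) else 0 := by
  rw [koszulD_apply, Finset.sum_apply, coeff_sum]
  refine Finset.sum_congr rfl fun v _ => ?_
  refine (map_zsmul (lcoeff K m) _ _).trans ?_
  rw [lcoeff_apply, coeff_mulX]

/-- The inclusion of the basis of the component of multidegree `a`. -/
def multidegreeLift (a : V →₀ ℕ) (g : Finset V → K) : Finset V → Fin 1 → MvPolynomial V K :=
  fun F _ => monomial (a - sqfreeExponent F) (g F)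

theorem multidegreeLift_mem (hP : ∀ m m', m ≤ m' → P m → P m') {a : V →₀ ℕ}
    {T : Finset (V →₀ ℕ)} (haT : a ∈ T) {p : ℤ} {g : Finset V → K}
    (hg : g ∈ familyChains K (upperKoszulFamily P a) p) :
    multidegreeLift a g ∈ (multidegreeStrand K hP T).C p := by
  intro F m hm
  rw [multidegreeLift, coeff_monomial] at hm
  split_ifs at hm with h
  · subst h
    obtain ⟨h1, h2⟩ := hg F hm
    refine ⟨h1.2, ?_, h2⟩
    rwa [tsub_add_cancel_of_le h1.1]
  · exact absurd rfl hm

theorem multidegreeComponent_lift {a : V →₀ ℕ} {p : ℤ} {g : Finset V → K}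
    (hg : g ∈ familyChains K (upperKoszulFamily P a) p) :
    multidegreeComponent K P a (multidegreeLift a g) = g := by
  funext F
  by_cases hF : F ∈ upperKoszulFamily P a
  · rw [multidegreeComponent_of_mem hF, multidegreeLift, coeff_monomial, if_pos rfl]
  · rw [multidegreeComponent_of_notMem hF]
    by_contra h
    exact hF (hg F (Ne.symm h)).1

/-- The differential preserves the multidegree `m + sqfreeExponent F`. In multidegree `a` the set
`F` determines the monomial, so the component has the family as its basis. -/
theorem isShortExact_multidegreeStrand (hP : ∀ m m', m ≤ m' → P m → P m') {a : V →₀ ℕ}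
    {T : Finset (V →₀ ℕ)} (haT : a ∉ T) :
    SubspaceComplex.IsShortExact (multidegreeStrand K hP T) (multidegreeStrand K hP (insert a T))
      (familyComplex K _ (upperKoszulFamily_ordConnected hP a)) LinearMap.id
      (multidegreeComponent K P a) where
  φ_mem := fun p f hf F m h => ⟨(hf F m h).1, Finset.mem_insert_of_mem (hf F m h).2.1,
    (hf F m h).2.2⟩
  ψ_mem := by
    intro p f hf F h
    by_cases hF : F ∈ upperKoszulFamily P a
    · rw [multidegreeComponent_of_mem hF] at h
      exact ⟨hF, (hf F _ h).2.2⟩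
    · exact absurd (multidegreeComponent_of_notMem hF f) h
  φ_D := fun p f _ => rfl
  ψ_D := by
    intro p f hf
    funext F
    change multidegreeComponent K P a (koszulD (mulX 1) f) F =
      familyProj K _ (simplexD K (multidegreeComponent K P a f)) F
    by_cases hF : F ∈ upperKoszulFamily P a
    · rw [multidegreeComponent_of_mem hF, familyProj_of_mem hF, coeff_koszulD, koszulD_apply]
      refine Finset.sum_congr rfl fun v hv => ?_
      have hv' : v ∉ F := by simpa using hv
      congr 1
      rw [tsub_tsub, ← sqfreeExponent_insert hv', LinearMap.id_apply]
      have hav : (a - sqfreeExponent F) v = a v := by simp [sqfreeExponent_apply, hv']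
      rw [hav]
      by_cases hF' : insert v F ∈ upperKoszulFamily P a
      · rw [multidegreeComponent_of_mem hF', if_pos]
        have := hF'.1 v
        rw [sqfreeExponent_apply, if_pos (Finset.mem_insert_self v F)] at this
        omega
      · rw [multidegreeComponent_of_notMem hF', ite_eq_right_iff]
        intro hv0
        by_contra hne
        refine hF' ⟨?_, (hf _ _ hne).1⟩
        rw [sqfreeExponent_le_iff]
        exact Finset.insert_subset (Finsupp.mem_support_iff.2 hv0)
          (sqfreeExponent_le_iff.1 hF.1)
    · rw [multidegreeComponent_of_notMem hF, familyProj_of_notMem hF]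
  inj := fun p f _ h => h
  zero := by
    intro p f hf
    funext F
    by_cases hF : F ∈ upperKoszulFamily P a
    · change multidegreeComponent K P a f F = 0
      rw [multidegreeComponent_of_mem hF]
      by_contra hne
      have := (hf F _ hne).2.1
      rw [tsub_add_cancel_of_le hF.1] at this
      exact haT this
    · exact multidegreeComponent_of_notMem hF f
  exact := by
    intro p f hf h
    refine ⟨f, fun F m hm => ?_, rfl⟩
    obtain ⟨h1, h2, h3⟩ := hf F m hm
    refine ⟨h1, (Finset.mem_insert.1 h2).resolve_left fun hma => ?_, h3⟩
    subst hma
    have hF : F ∈ upperKoszulFamily P (m + sqfreeExponent F) := by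
      refine ⟨le_add_self, ?_⟩
      rwa [add_tsub_cancel_right]
    have := congrFun h F
    rw [multidegreeComponent_of_mem hF, add_tsub_cancel_right] at this
    exact hm this
  surj := fun p g hg => ⟨multidegreeLift a g,
    multidegreeLift_mem hP (Finset.mem_insert_self a T) hg, multidegreeComponent_lift hg⟩

/-- The boundary of the lift lives in multidegree `a` alone, and its component there vanishes by
hypothesis. -/
theorem koszulD_multidegreeLift (hP : ∀ m m', m ≤ m' → P m → P m') {a : V →₀ ℕ} {p : ℤ}
    {g : Finset V → K} (hg : g ∈ familyChains K (upperKoszulFamily P a) p)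
    (hD : (familyComplex K _ (upperKoszulFamily_ordConnected hP a)).D g = 0) :
    koszulD (mulX 1) (multidegreeLift a g) = 0 := by
  have hlift : multidegreeLift a g ∈ (multidegreeStrand K hP {a}).C p :=
    multidegreeLift_mem hP (Finset.mem_singleton_self a) hg
  have hmem := (multidegreeStrand K hP {a}).D_mem (p - 1) (multidegreeLift a g)
    (by simpa using hlift)
  have hS := isShortExact_multidegreeStrand (K := K) hP (a := a) (T := ∅) (by simp)
  obtain ⟨y, hy, hy'⟩ := hS.exact (p - 1) _ hmem (by
    have := hS.ψ_D p _ hlift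
    rw [multidegreeComponent_lift hg, hD] at this
    exact this)
  have hy0 : y = 0 := by
    funext F i
    ext m
    rw [Subsingleton.elim i 0]
    by_contra h
    simpa using (hy F m h).2.1
  rw [hy0, map_zero] at hy'
  exact hy'.symm

/-- Multidegrees are added one at a time; cycles in the new component lift to cycles, so all
connecting maps vanish. -/
theorem hdim_multidegreeStrand (hP : ∀ m m', m ≤ m' → P m → P m') (T : Finset (V →₀ ℕ)) (p : ℤ) :
    (multidegreeStrand K hP T).hdim p = ∑ a ∈ T, familyH K (upperKoszulFamily P a) p := by
  induction T using Finset.induction_on with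
  | empty =>
    refine SubspaceComplex.hdim_eq_zero fun f hf _ => ⟨0, zero_mem _, ?_⟩
    rw [map_zero]
    funext F i
    ext m
    rw [Subsingleton.elim i 0]
    by_contra h
    simpa using (hf F m (Ne.symm h)).2.1
  | insert a T ha ih =>
    obtain ⟨r, s, t, h1, h2, h3, -, -, h6⟩ :=
      (isShortExact_multidegreeStrand (K := K) hP ha).exists_ranks
    have ht : ∀ p, t p = 0 := fun p => h6 p fun g hg hD =>
      ⟨multidegreeLift a g, multidegreeLift_mem hP (Finset.mem_insert_self a T) hg,
        koszulD_multidegreeLift hP hg hD, multidegreeComponent_lift hg⟩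
    rw [Finset.sum_insert ha, ← ih, familyH_eq K (upperKoszulFamily_ordConnected hP a), h1, h2, h3,
      ht, ht, zero_add, add_zero, add_comm]

end Multidegrees

/-! ### Squarefree powers of edge ideals -/

section EdgeIdeal

variable {V : Type*} {G : SimpleGraph V} {k : ℕ}

theorem mem_matchingVertices {M : Finset (Sym2 V)} {v : V} :
    v ∈ matchingVertices M ↔ ∃ e ∈ M, v ∈ e := by
  simp [matchingVertices]

variable [LinearOrder V]

theorem hasMatching_iff {U : Finset V} :
    HasMatching G k U ↔ ∃ M, IsKMatching G k M ∧ matchingVertices M ⊆ U := by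
  induction k generalizing U with
  | zero =>
    refine ⟨fun _ => ⟨∅, ⟨by simp, rfl, by simp⟩, ?_⟩, fun _ => trivial⟩
    intro v hv
    simp [mem_matchingVertices] at hv
  | succ k ih =>
    constructor
    · rintro ⟨a, b, ha, hb, hab, h⟩
      obtain ⟨M, hM, hMU⟩ := ih.1 h
      have hd : ∀ e ∈ M, ∀ v ∈ e, v ∈ U \ {a, b} := fun e he v hv =>
        hMU (mem_matchingVertices.2 ⟨e, he, hv⟩)
      have hnot : s(a, b) ∉ M := fun h => by
        have := hd _ h a (Sym2.mem_mk_left a b)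
        simp at this
      refine ⟨insert s(a, b) M, ⟨?_, ?_, ?_⟩, ?_⟩
      · intro e he
        rcases Finset.mem_insert.1 he with rfl | he
        · exact hab
        · exact hM.subset_edgeSet e he
      · rw [Finset.card_insert_of_notMem hnot, hM.card_eq]
      · intro e he e' he' hne v hv hv'
        rcases Finset.mem_insert.1 he with rfl | he <;>
          rcases Finset.mem_insert.1 he' with rfl | he'
        · exact hne rfl
        · have := hd e' he' v hv'
          rw [Sym2.mem_iff] at hv
          grind
        · have := hd e he v hv
          rw [Sym2.mem_iff] at hv'
          grind
        · exact hM.pairwise_disjoint e he e' he' hne v hv hv'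
      · intro v hv
        obtain ⟨e, he, hve⟩ := mem_matchingVertices.1 hv
        rcases Finset.mem_insert.1 he with rfl | he
        · rw [Sym2.mem_iff] at hve
          rcases hve with rfl | rfl <;> assumption
        · exact (Finset.mem_sdiff.1 (hd e he v hve)).1
    · rintro ⟨M, hM, hMU⟩
      obtain ⟨e, he⟩ : M.Nonempty := Finset.card_pos.1 (by rw [hM.card_eq]; omega)
      induction e using Sym2.ind with
      | h a b =>
        refine ⟨a, b, hMU (mem_matchingVertices.2 ⟨_, he, Sym2.mem_mk_left a b⟩),
          hMU (mem_matchingVertices.2 ⟨_, he, Sym2.mem_mk_right a b⟩), hM.subset_edgeSet _ he, ?_⟩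
        refine ih.2 ⟨M.erase s(a, b),
          ⟨fun e' he' => hM.subset_edgeSet e' (Finset.mem_of_mem_erase he'),
          ?_, fun e' he' e'' he'' => hM.pairwise_disjoint e' (Finset.mem_of_mem_erase he') e''
            (Finset.mem_of_mem_erase he'')⟩, ?_⟩
        · rw [Finset.card_erase_of_mem he, hM.card_eq, Nat.add_sub_cancel]
        · intro v hv
          obtain ⟨e', he', hve⟩ := mem_matchingVertices.1 hv
          have hdis := hM.pairwise_disjoint e' (Finset.mem_of_mem_erase he') _ he
            (Finset.ne_of_mem_erase he') v hve
          rw [Sym2.mem_iff] at hdis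
          have := hMU (mem_matchingVertices.2 ⟨e', Finset.mem_of_mem_erase he', hve⟩)
          grind

theorem hasMatching_support_mono (m m' : V →₀ ℕ) (h : m ≤ m')
    (hm : HasMatching G k m.support) : HasMatching G k m'.support :=
  hm.mono (Finsupp.support_mono h)

variable [Fintype V]

theorem prod_X_eq_monomial {K : Type*} [Field K] (F : Finset V) :
    (∏ v ∈ F, X v : MvPolynomial V K) = monomial (sqfreeExponent F) 1 := by
  induction F using Finset.induction_on with
  | empty =>
    rw [Finset.prod_empty, show sqfreeExponent (∅ : Finset V) = 0 from by ext; rfl]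
    rfl
  | insert v F hv ih =>
    rw [Finset.prod_insert hv, ih, sqfreeExponent_insert hv, X, monomial_mul, mul_one, add_comm]

theorem mem_edgeIdealSqfreePower_iff {K : Type*} [Field K] {f : MvPolynomial V K} :
    f ∈ edgeIdealSqfreePower K G k ↔ ∀ m ∈ f.support, HasMatching G k m.support := by
  have hset : {p : MvPolynomial V K | ∃ M : Finset (Sym2 V),
      IsKMatching G k M ∧ p = ∏ v ∈ matchingVertices M, X v} =
      (fun s => monomial s (1 : K)) ''
        {s | ∃ M, IsKMatching G k M ∧ s = sqfreeExponent (matchingVertices M)} := by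
    ext p
    constructor
    · rintro ⟨M, hM, rfl⟩
      exact ⟨_, ⟨M, hM, rfl⟩, (prod_X_eq_monomial _).symm⟩
    · rintro ⟨_, ⟨M, hM, rfl⟩, rfl⟩
      exact ⟨M, hM, (prod_X_eq_monomial _).symm⟩
  rw [edgeIdealSqfreePower, hset, mem_ideal_span_monomial_image]
  refine forall₂_congr fun m _ => ?_
  rw [hasMatching_iff]
  constructor
  · rintro ⟨_, ⟨M, hM, rfl⟩, h⟩
    exact ⟨M, hM, sqfreeExponent_le_iff.1 h⟩
  · rintro ⟨M, hM, h⟩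
    exact ⟨_, ⟨M, hM, rfl⟩, sqfreeExponent_le_iff.2 h⟩

theorem SubspaceComplex.hdim_congr {K E : Type*} [Field K] [AddCommGroup E] [Module K E]
    {c c' : SubspaceComplex K E} (hC : c.C = c'.C) (hD : c.D = c'.D) (p : ℤ) :
    c.hdim p = c'.hdim p := by
  rw [hdim, hdim, B, B, Z, Z, hC, hD]

/-- The strand of total degree `j` is the part of the Koszul complex in the finitely many
multidegrees of sum `j`. -/
theorem hdim_koszulStrand_edgeIdeal (K : Type*) [Field K] (j : ℕ) (p : ℤ) :
    (koszulStrand (fun _ => 0) (idealSubmodule (edgeIdealSqfreePower K G k)) (j : ℤ)).hdim p =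
      ∑ a ∈ Finset.univ.finsuppAntidiag j,
        familyH K (upperKoszulFamily (fun m => HasMatching G k m.support) a) p := by
  let c := koszulStrand (fun _ => 0) (idealSubmodule (edgeIdealSqfreePower K G k)) (j : ℤ)
  let c' := multidegreeStrand K (P := fun m => HasMatching G k m.support) hasMatching_support_mono
    (Finset.univ.finsuppAntidiag j)
  have hdeg : ∀ (F : Finset V) (m : V →₀ ℕ),
      m + sqfreeExponent F ∈ Finset.univ.finsuppAntidiag j ↔ m.degree + F.card = j := by
    intro F m
    rw [Finset.mem_finsuppAntidiag, ← Finsupp.degree_eq_sum, map_add, degree_sqfreeExponent]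
    simp
  have hC : ∀ q f, f ∈ c.C q ↔ f ∈ c'.C q := by
    intro q f
    constructor
    · intro hf F m hm
      obtain ⟨h1, h2, h3⟩ := hf F
      have hcard := h3 fun h0 => hm (by rw [h0]; exact coeff_zero _)
      have h4 := h2 0 m hm
      refine ⟨mem_edgeIdealSqfreePower_iff.1 h1 m (mem_support_iff.2 hm), (hdeg F m).2 ?_, hcard⟩
      push_cast at h4
      omega
    · intro hf F
      refine ⟨mem_edgeIdealSqfreePower_iff.2 fun m hm => (hf F m (mem_support_iff.1 hm)).1, ?_, ?_⟩
      · intro b m hm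
        rw [Subsingleton.elim b 0] at hm
        obtain ⟨-, h2, h3⟩ := hf F m hm
        rw [hdeg] at h2
        push_cast
        omega
      · intro h
        have : f F 0 ≠ 0 := fun h0 => h (funext fun b => by rw [Subsingleton.elim b 0, h0]; rfl)
        obtain ⟨m, hm⟩ := ne_zero_iff.1 this
        exact (hf F m hm).2.2
  rw [← hdim_multidegreeStrand (K := K) (P := fun m => HasMatching G k m.support)
    hasMatching_support_mono]
  exact SubspaceComplex.hdim_congr (c := c) (c' := c') (funext fun q => Submodule.ext (hC q)) rfl p

/-- Membership in the ideal depends only on the support of a monomial. If `a v ≥ 2`, removing one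
factor `x_v` does not change the support, so `v` is a cone apex; otherwise `a` is squarefree. -/
theorem sameHomology_upperKoszulFamily (hG : G.IsAcyclic) (K L : Type*) [Field K] [Field L]
    (a : V →₀ ℕ) :
    SameHomology K L (upperKoszulFamily (fun m => HasMatching G k m.support) a) := by
  by_cases ha : ∃ v, 2 ≤ a v
  · obtain ⟨v, hv⟩ := ha
    refine SameHomology.of_toggle (v := v) (fun F hF => ?_)
      (upperKoszulFamily_ordConnected hasMatching_support_mono a)
    refine and_congr ?_ ?_
    · rw [sqfreeExponent_le_iff, sqfreeExponent_le_iff, Finset.insert_subset_iff,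
        Finsupp.mem_support_iff]
      exact ⟨fun h => ⟨by omega, h⟩, fun h => h.2⟩
    · have : (a - sqfreeExponent F).support = (a - sqfreeExponent (insert v F)).support := by
        ext w
        rw [Finsupp.mem_support_iff, Finsupp.mem_support_iff, sqfreeExponent_insert hF,
          Finsupp.tsub_apply, Finsupp.tsub_apply, Finsupp.add_apply]
        by_cases hw : w = v
        · subst hw
          rw [sqfreeExponent_apply, if_neg hF, Finsupp.single_eq_same]
          omega
        · rw [Finsupp.single_eq_of_ne hw, add_zero]
      dsimp only
      rw [this]
  · push Not at ha
    have : upperKoszulFamily (fun m => HasMatching G k m.support) a =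
        matchFamily G a.support k := by
      ext F
      refine and_congr sqfreeExponent_le_iff ?_
      have : (a - sqfreeExponent F).support = a.support \ F := by
        ext w
        rw [Finset.mem_sdiff, Finsupp.mem_support_iff, Finsupp.mem_support_iff,
          Finsupp.tsub_apply, sqfreeExponent_apply]
        have := ha w
        split_ifs with h <;> simp [h]
        omega
      dsimp only
      rw [this]
    rw [this]
    exact sameHomology_matchFamily hG _ _

theorem betti_eq_betti (hG : G.IsAcyclic) {K L : Type*} [Field K] [Field L]
    (F : MinimalGradedFreeResolution (edgeIdealSqfreePower K G k))
    (F' : MinimalGradedFreeResolution (edgeIdealSqfreePower L G k)) (i j : ℕ) :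
    F.betti i j = F'.betti i j := by
  have : (F.betti i j : ℕ∞) = F'.betti i j := by
    rw [F.betti_eq, F'.betti_eq, hdim_koszulStrand_edgeIdeal, hdim_koszulStrand_edgeIdeal]
    exact Finset.sum_congr rfl fun a _ => sameHomology_upperKoszulFamily hG K L a i
  exact_mod_cast this

end EdgeIdeal


/-! ### Existence of minimal graded free resolutions -/

section Existence

variable {V K : Type*} [Field K]

theorem mem_span_range_X_iff {f : MvPolynomial V K} :
    f ∈ Ideal.span (Set.range (X : V → MvPolynomial V K)) ↔ constantCoeff f = 0 := by
  refine ⟨constantCoeff_eq_zero_of_mem_span, fun h => ?_⟩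
  rw [← Set.image_univ, mem_ideal_span_X_image]
  intro m hm
  by_contra! h'
  have : m = 0 := Finsupp.ext fun v => h' v (Set.mem_univ v)
  rw [this, mem_support_iff] at hm
  exact hm h

theorem exists_sum_gradedProj {r : ℕ} (deg : Fin r → ℕ) (f : Fin r → MvPolynomial V K) :
    ∃ B : ℕ, f = ∑ n ∈ Finset.range B, gradedProj deg (n : ℤ) f := by
  refine ⟨(Finset.univ.sup fun b => (f b).support.sup fun m => m.degree + deg b) + 1, ?_⟩
  funext b
  ext m
  rw [Finset.sum_apply, coeff_sum]
  simp only [coeff_gradedProj]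
  by_cases hm : coeff m (f b) = 0
  · simp [hm]
  · rw [Finset.sum_eq_single (m.degree + deg b)]
    · rw [if_pos (by push_cast; rfl)]
    · intro n _ hn
      rw [if_neg]
      exact fun h => hn (by exact_mod_cast h.symm)
    · intro h
      refine absurd (Finset.mem_range.2 (Nat.lt_succ_of_le ?_)) h
      exact (Finset.le_sup (f := fun m => m.degree + deg b) (mem_support_iff.2 hm)).trans
        (Finset.le_sup (f := fun b => (f b).support.sup fun m => m.degree + deg b)
          (Finset.mem_univ b))

/-- `s` homogeneous vectors of degrees `e` generating `N`. -/
def IsHomogeneousGenerators {r s : ℕ} (deg : Fin r → ℕ)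
    (N : Submodule (MvPolynomial V K) (Fin r → MvPolynomial V K)) (e : Fin s → ℕ)
    (g : Fin s → Fin r → MvPolynomial V K) : Prop :=
  (∀ i, g i ∈ gradedPiece deg (e i)) ∧ Submodule.span (MvPolynomial V K) (Set.range g) = N

theorem exists_homogeneousGenerators [Finite V] {r : ℕ} (deg : Fin r → ℕ)
    (N : Submodule (MvPolynomial V K) (Fin r → MvPolynomial V K))
    (hN : ∀ n, ∀ f ∈ N, gradedProj deg n f ∈ N) :
    ∃ (s : ℕ) (e : Fin s → ℕ) (g : Fin s → Fin r → MvPolynomial V K),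
      IsHomogeneousGenerators deg N e g := by
  have hspan : Submodule.span (MvPolynomial V K) {f | f ∈ N ∧ ∃ n : ℕ, f ∈ gradedPiece deg n} =
      N := by
    apply le_antisymm
    · exact Submodule.span_le.2 fun f hf => hf.1
    · intro f hf
      obtain ⟨B, hB⟩ := exists_sum_gradedProj deg f
      rw [hB]
      exact sum_mem fun n _ => Submodule.subset_span ⟨hN n f hf, n, gradedProj_mem deg n f⟩
  have hfg : N.FG := IsNoetherian.noetherian N
  rw [← hspan, Submodule.fg_span_iff_fg_span_finset_subset] at hfg
  obtain ⟨T, hT, hTN⟩ := hfg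
  choose e he using fun i : Fin T.card => (hT (T.equivFin.symm i).2).2
  refine ⟨T.card, e, fun i => T.equivFin.symm i, he, ?_⟩
  rw [← hspan, hTN]
  congr 1
  ext f
  constructor
  · rintro ⟨i, rfl⟩
    exact (T.equivFin.symm i).2
  · intro hf
    exact ⟨T.equivFin ⟨f, hf⟩, by simp⟩

/-- A graded submodule of a graded free module has a minimal graded free cover. -/
theorem exists_minimal_cover [Finite V] {r : ℕ} (deg : Fin r → ℕ)
    (N : Submodule (MvPolynomial V K) (Fin r → MvPolynomial V K))
    (hN : ∀ n, ∀ f ∈ N, gradedProj deg n f ∈ N) :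
    ∃ (s : ℕ) (e : Fin s → ℕ)
      (φ : (Fin s → MvPolynomial V K) →ₗ[MvPolynomial V K] (Fin r → MvPolynomial V K)),
      IsGradedMap e deg φ ∧ LinearMap.range φ = N ∧
      ∀ f, φ f = 0 → ∀ b, constantCoeff (f b) = 0 := by
  classical
  have hex := exists_homogeneousGenerators deg N hN
  -- A homogeneous generating family with the least possible number `s` of members.
  obtain ⟨s, ⟨e, g, hg, hspan⟩, hmin⟩ : ∃ s, (∃ (e : Fin s → ℕ) (g : Fin s → Fin r →
      MvPolynomial V K), IsHomogeneousGenerators deg N e g) ∧ ∀ s' < s, ¬ ∃ (e : Fin s' → ℕ)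
      (g : Fin s' → Fin r → MvPolynomial V K), IsHomogeneousGenerators deg N e g :=
    ⟨Nat.find hex, Nat.find_spec hex, fun _ => Nat.find_min hex⟩
  have hgr : IsGradedMap e deg (Fintype.linearCombination (MvPolynomial V K) g) := fun a => by
    rw [Fintype.linearCombination_apply_single, one_smul, isHomogeneousVector_iff]
    exact hg a
  refine ⟨s, e, Fintype.linearCombination _ g, hgr,
    by rw [Fintype.range_linearCombination, hspan], fun f hf a => ?_⟩
  by_contra hc
  -- In degree `e a` the coefficient of `g a` becomes the nonzero constant `constantCoeff (f a)`.
  -- Inverting it makes `g a` redundant, against the choice of `s`.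
  have hf' : Fintype.linearCombination (MvPolynomial V K) g (gradedProj e (e a) f) = 0 := by
    rw [hgr.map_gradedProj, hf, map_zero]
  set f' := gradedProj e (e a) f with hf'def
  have hfa : f' a = C (constantCoeff (f a)) := by
    ext m
    rw [hf'def, coeff_gradedProj, coeff_C]
    by_cases hm : m = 0
    · subst hm
      simp [constantCoeff_eq]
    · rw [if_neg, if_neg (Ne.symm hm)]
      rw [add_eq_right]
      exact_mod_cast fun h => hm ((Finsupp.degree_eq_zero_iff m).1 h)
  obtain ⟨s', hs'⟩ : ∃ s', s = s' + 1 := ⟨s - 1, by have := a.2; omega⟩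
  have hmem : ∀ b, b ≠ a → g b ∈ Submodule.span (MvPolynomial V K) (g '' {a}ᶜ) := fun b hb =>
    Submodule.subset_span ⟨b, hb, rfl⟩
  have hga : g a ∈ Submodule.span (MvPolynomial V K) (g '' {a}ᶜ) := by
    rw [Fintype.linearCombination_apply, ← Finset.add_sum_erase _ _ (Finset.mem_univ a),
      hfa, add_eq_zero_iff_eq_neg] at hf'
    have h1 : (C (constantCoeff (f a)) : MvPolynomial V K) • g a ∈
        Submodule.span (MvPolynomial V K) (g '' {a}ᶜ) := by
      rw [hf']
      exact neg_mem (sum_mem fun b hb => Submodule.smul_mem _ _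
        (hmem b (Finset.ne_of_mem_erase hb)))
    have h2 := Submodule.smul_mem _ (C (constantCoeff (f a))⁻¹ : MvPolynomial V K) h1
    rwa [smul_smul, ← C_mul, inv_mul_cancel₀ hc, C_1, one_smul] at h2
  subst hs'
  refine hmin s' (Nat.lt_succ_self s') ⟨e ∘ a.succAbove, g ∘ a.succAbove, fun i => hg _, ?_⟩
  rw [← hspan, Set.range_comp, Fin.range_succAbove]
  apply le_antisymm
  · exact Submodule.span_mono (Set.image_subset_range _ _)
  · rw [Submodule.span_le]
    rintro _ ⟨b, rfl⟩
    by_cases hb : b = a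
    · subst hb; exact hga
    · exact hmem b hb

/-- A graded submodule of a graded free module. -/
structure GradedSubmodule (V K : Type*) [Field K] where
  /-- the rank of the ambient free module -/
  rank : ℕ
  /-- the degrees of the basis vectors -/
  deg : Fin rank → ℕ
  /-- the submodule -/
  N : Submodule (MvPolynomial V K) (Fin rank → MvPolynomial V K)
  graded : ∀ n, ∀ f ∈ N, gradedProj deg n f ∈ N

namespace GradedSubmodule

variable [Finite V] (M : GradedSubmodule V K)

/-- the rank of a minimal cover -/
def coverRank : ℕ := (exists_minimal_cover M.deg M.N M.graded).choose

/-- the degrees of a minimal cover -/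
def coverDeg : Fin M.coverRank → ℕ :=
  (exists_minimal_cover M.deg M.N M.graded).choose_spec.choose

/-- a minimal cover -/
def cover : (Fin M.coverRank → MvPolynomial V K) →ₗ[MvPolynomial V K]
    (Fin M.rank → MvPolynomial V K) :=
  (exists_minimal_cover M.deg M.N M.graded).choose_spec.choose_spec.choose

theorem cover_spec : IsGradedMap M.coverDeg M.deg M.cover ∧ LinearMap.range M.cover = M.N ∧
    ∀ f, M.cover f = 0 → ∀ b, constantCoeff (f b) = 0 :=
  (exists_minimal_cover M.deg M.N M.graded).choose_spec.choose_spec.choose_spec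

/-- The first syzygy module. -/
abbrev syzygy : GradedSubmodule V K where
  rank := M.coverRank
  deg := M.coverDeg
  N := LinearMap.ker M.cover
  graded := fun n f hf => by
    rw [LinearMap.mem_ker] at hf ⊢
    rw [M.cover_spec.1.map_gradedProj, hf, map_zero]

/-- The iterated syzygy modules. -/
def syzygies : ℕ → GradedSubmodule V K
  | 0 => M
  | i + 1 => (syzygies i).syzygy

theorem exact_cover_syzygy : Function.Exact M.syzygy.cover M.cover :=
  LinearMap.exact_iff.2 M.syzygy.cover_spec.2.1.symm

end GradedSubmodule

/-- A homogeneous ideal has a minimal graded free resolution. -/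
theorem nonempty_minimalGradedFreeResolution [Finite V] {I : Ideal (MvPolynomial V K)}
    (hI : ∀ n, ∀ f ∈ idealSubmodule I, gradedProj (fun _ => 0) n f ∈ idealSubmodule I) :
    Nonempty (MinimalGradedFreeResolution I) := by
  let M : GradedSubmodule V K := ⟨1, fun _ => 0, idealSubmodule I, hI⟩
  refine ⟨{
    rank := fun i => (M.syzygies i).coverRank
    deg := fun i => (M.syzygies i).coverDeg
    aug := LinearMap.proj 0 ∘ₗ M.cover
    d := fun i => (M.syzygies (i + 1)).cover
    aug_homogeneous := ?_
    d_homogeneous := fun i => (M.syzygies (i + 1)).cover_spec.1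
    range_aug := ?_
    exact_zero := ?_
    exact_succ := fun i => (M.syzygies (i + 1)).exact_cover_syzygy
    minimal := ?_ }⟩
  · intro a m hm
    have h := M.cover_spec.1 a 0 m (mem_support_iff.2 hm)
    have h' : m.degree = M.coverDeg a := h
    rw [Finsupp.degree_eq_weight_one] at h'
    exact h'
  · ext f
    have hmem : ∀ g, g ∈ LinearMap.range M.cover ↔ g 0 ∈ I := fun g => by
      rw [M.cover_spec.2.1]
      exact Iff.rfl
    constructor
    · rintro ⟨g, rfl⟩
      exact (hmem _).1 ⟨g, rfl⟩
    · intro hf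
      obtain ⟨g, hg⟩ := (hmem fun _ => f).2 hf
      exact ⟨g, congrFun hg 0⟩
  · intro f
    refine Iff.trans ?_ (M.exact_cover_syzygy f)
    exact ⟨fun h => funext fun b => (congrArg (M.cover f) (Subsingleton.elim b 0)).trans h,
      fun h => congrFun h 0⟩
  · intro i f b
    rw [mem_span_range_X_iff]
    -- The image of each differential is the kernel of the preceding minimal cover, whose elements
    -- have no constant terms.
    refine (M.syzygies i).cover_spec.2.2 _ ?_ b
    exact (M.syzygies i).exact_cover_syzygy.apply_apply_eq_zero f

theorem nonempty_resolution_edgeIdealSqfreePower [Finite V] (G : SimpleGraph V) (k : ℕ) :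
    Nonempty (MinimalGradedFreeResolution (edgeIdealSqfreePower K G k)) := by
  have := Fintype.ofFinite V
  let _ : LinearOrder V := LinearOrder.lift' (Fintype.equivFin V) (Fintype.equivFin V).injective
  refine nonempty_minimalGradedFreeResolution fun n f hf => ?_
  have hf' : f 0 ∈ edgeIdealSqfreePower K G k := hf
  change gradedProj (fun _ => 0) n f 0 ∈ edgeIdealSqfreePower K G k
  rw [mem_edgeIdealSqfreePower_iff] at hf' ⊢
  refine fun m hm => hf' m ?_
  rw [mem_support_iff] at hm ⊢
  rw [coeff_gradedProj] at hm
  exact fun h => hm (by rw [h, ite_self])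

end Existence

end

theorem mainTheorem8 {V : Type*} [Finite V] (G : SimpleGraph V) (hG : G.IsAcyclic) (k : ℕ)
    (K : Type*) [Field K] (L : Type*) [Field L] :
    Nonempty (MinimalGradedFreeResolution (edgeIdealSqfreePower K G k)) ∧
    Nonempty (MinimalGradedFreeResolution (edgeIdealSqfreePower L G k)) ∧
    ∀ (F : MinimalGradedFreeResolution (edgeIdealSqfreePower K G k))
      (F' : MinimalGradedFreeResolution (edgeIdealSqfreePower L G k)) (i j : ℕ),
      F.betti i j = F'.betti i j := by
  have := Fintype.ofFinite V
  -- An arbitrary order on the vertices, needed only to fix the Koszul signs.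
  let _ : LinearOrder V := LinearOrder.lift' (Fintype.equivFin V) (Fintype.equivFin V).injective
  exact ⟨nonempty_resolution_edgeIdealSqfreePower G k, nonempty_resolution_edgeIdealSqfreePower G k,
    betti_eq_betti hG⟩
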